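/- Let $\Phi=\{\Phi(t)\}_{t\in\mathbb R}$ be a (jointly measurable) real-valued, mean-square continuous, stationary Gaussian process whose covariance function has a spectral density $p:\mathbb R\to(0,\infty)$, $p\in L^1(\mathbb R)$, i.e. $\operatorname{Cov}(\Phi(t),\Phi(0))=\int_{\mathbb R}e^{it\lambda}p(\lambda)\,d\lambda$ for all $t$. Assume that there are constants $\gamma\in(0,2)$ and $C_1>0$ with $p(\lambda)\le C_1|\lambda|^{-(1+\gamma)}$ for all $\lambda\ne0$, and that one of the following holds: (b1) $p(\lambda)=L(|\lambda|^{-1})|\lambda|^{H-1}$ for $\lambda\neq 0$, where $H\in(0,1)$ and $L:(0,\infty)\to(0,\infty)$ is locally bounded and slowly varying at infinity ($L(cr)/L(r)\to1$ as $r\to\infty$ for every $c>0$); (b2) $p$ is bounded and is continuous at the origin. Let $\psi\in L^1(\mathbb R)\cap L^2(\mathbb R)$ be complex-valued, let $\widehat\psi(\omega)=\int_{\mathbb R}e^{-it\omega}\psi(t)\,dt$, and assume that $\psi$ is analytic, i.e. $\widehat\psi(\omega)=0$ for $\omega\le0$, and that $\widehat\psi$ is Lipschitz continuous on $[0,\infty)$,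 with smallest Lipschitz constant $\|\widehat\psi\|_{\mathrm{Lip}}$. For $s>0$ put $$W_\Phi(0,s)=\int_{\mathbb R}\Phi(\tau)\,\frac1s\,\overline{\psi\!\left(\frac{\tau}{s}\right)}\,d\tau .$$ Fix $H^-\in(0,H)$ in case (b1), and $H^-\in(0,1]$ in case (b2). Then: 1. The process $(W_\Phi(0,s))_{s>0}$ has a version with almost surely continuous paths on $(0,\infty)$; suprema over $s>0$ are taken for such a version. 2. If $H^-<1$ (which is automatic in case (b1)), there is a threshold $T>0$ such that $$\mathbb E\big[|W_\Phi(0,s)|^2\big]\le s^{-H^-}\qquad\text{for all } s\ge T. \tag{$*$}$$ 3. For every $T>0$ satisfying $(*)$ and every version of $(W_\Phi(0,s))_{s>0}$ with almost surely continuous paths, $$\mathbb E\Big[\sup_{s>0}|W_\Phi(0,s)|\Big]\le 4\left[\sqrt{\ln\mathcal D}\,\frac{\mathcal D^3}{(\mathcal D-1)^2}\sqrt{\frac1\gamma+\frac1{H^-}}+\left(\sqrt{\frac1\gamma\ln C_2}+\sqrt{\ln (T\vee 1)}\right)\frac{\mathcal D^2}{\mathcal D-1}\right],$$ where $$\mathcal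 D=2\vee\Big\{\sup_{s>0}\mathbb E\big[|W_\Phi(0,s)|^2\big]\Big\}^{1/2},$$ $$C_2=1\vee\Big[C_1\Big(\frac1\gamma+\frac2{2-\gamma}\Big)(2\|\widehat\psi\|_\infty)^{2-\gamma}\|\widehat\psi\|_{\mathrm{Lip}}^{\gamma}+2\|\widehat\psi\|_\infty^2\operatorname{Var}(\Phi(0))\Big]^{1/2}.$$ -/

import Mathlib

open MeasureTheory ProbabilityTheory Filter Topology Set

noncomputable section

namespace AWT

/-! ### Analytic wavelet transform -/

/-- The Fourier transform `ψ̂(ω) = ∫ e^{-itω} ψ(t) dt`. -/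
def fourierHat (ψ : ℝ → ℂ) (ω : ℝ) : ℂ :=
  ∫ t : ℝ, Complex.exp (-(Complex.I * (t : ℂ) * (ω : ℂ))) * ψ t

/-- `ψ ∈ L¹ ∩ L²` and `ψ̂(ω) = 0` for all `ω ≤ 0`. -/
structure IsAnalyticWavelet (ψ : ℝ → ℂ) : Prop where
  integrable : Integrable ψ
  memLp_two : MemLp ψ 2
  fourierHat_eq_zero : ∀ ω : ℝ, ω ≤ 0 → fourierHat ψ ω = 0

/-- `W_f(t,s) = ∫ f(τ) s⁻¹ conj (ψ((τ - t)/s)) dτ`. -/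
def awt (ψ : ℝ → ℂ) (f : ℝ → ℂ) (t s : ℝ) : ℂ :=
  ∫ τ : ℝ, f τ * ((1 / s : ℝ) : ℂ) * (starRingEnd ℂ) (ψ ((τ - t) / s))

/-- The supremum norm `‖g‖_∞`. -/
def supNorm (g : ℝ → ℂ) : ℝ := ⨆ x : ℝ, ‖g x‖

/-- The (smallest) Lipschitz constant of `g` on `[0, ∞)`. -/
def lipConst (g : ℝ → ℂ) : ℝ :=
  ⨆ q : Ici (0 : ℝ) × Ici (0 : ℝ),
    ‖g (q.1 : ℝ) - g (q.2 : ℝ)‖ / |(q.1 : ℝ) - (q.2 : ℝ)|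

/-! ### The noise -/

/-- A strictly stationary process: finite dimensional laws are invariant under time shifts. -/
def IsStationary {Ω : Type*} [MeasurableSpace Ω] (P : Measure Ω) (Φ : ℝ → Ω → ℝ) : Prop :=
  ∀ (h : ℝ) (n : ℕ) (t : Fin n → ℝ),
    IdentDistrib (fun ω i => Φ (t i + h) ω) (fun ω i => Φ (t i) ω) P P

/-- A mean-square continuous stationary (real) Gaussian process whose covariance function has the
spectral density `p : ℝ → (0, ∞)`. -/
structure IsGaussianNoise {Ω : Type*} [MeasurableSpace Ω] (P : Measure Ω) (Φ : ℝ → Ω → ℝ)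
    (p : ℝ → ℝ) : Prop where
  gaussian : IsGaussianProcess Φ P
  stationary : IsStationary P Φ
  meanSquare_continuous :
    ∀ t : ℝ, Tendsto (fun u : ℝ => ∫ ω, (Φ u ω - Φ t ω) ^ 2 ∂P) (𝓝 t) (𝓝 0)
  density_pos : ∀ l : ℝ, 0 < p l
  density_integrable : Integrable p
  covariance_eq : ∀ t : ℝ, ((cov[Φ t, Φ 0; P] : ℝ) : ℂ) =
    ∫ l : ℝ, Complex.exp (Complex.I * (t : ℂ) * (l : ℂ)) * ((p l : ℝ) : ℂ)

/-- `p(λ) ≤ C₁ |λ|^{-(1+γ)}` for `λ ≠ 0`, with `γ ∈ (0,2)` and `C₁ > 0`. -/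
structure HighFrequencyDecay (p : ℝ → ℝ) (γ C₁ : ℝ) : Prop where
  gamma_pos : 0 < γ
  gamma_lt_two : γ < 2
  const_pos : 0 < C₁
  bound : ∀ l : ℝ, l ≠ 0 → p l ≤ C₁ * |l| ^ (-(1 + γ))

/-- `L : (0,∞) → (0,∞)` is locally bounded and slowly varying at infinity. -/
structure IsSlowlyVarying (L : ℝ → ℝ) : Prop where
  pos : ∀ r : ℝ, 0 < r → 0 < L r
  locally_bounded : ∀ a b : ℝ, 0 < a → ∃ M : ℝ, ∀ r ∈ Icc a b, L r ≤ M
  ratio_tendsto : ∀ c : ℝ, 0 < c → Tendsto (fun r : ℝ => L (c * r) / L r) atTop (𝓝 1)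

/-- Long-range dependence with long-memory parameter `H ∈ (0,1)`:
`p(λ) = L(|λ|⁻¹) |λ|^{H-1}` with `L` slowly varying. -/
def LongRangeDependent (p : ℝ → ℝ) (H : ℝ) : Prop :=
  0 < H ∧ H < 1 ∧ ∃ L : ℝ → ℝ, IsSlowlyVarying L ∧
    ∀ l : ℝ, l ≠ 0 → p l = L (|l|⁻¹) * |l| ^ (H - 1)

/-- Short-range dependence: `p` is bounded, and continuous at the origin. -/
def ShortRangeDependent (p : ℝ → ℝ) : Prop :=
  (∃ M : ℝ, ∀ l : ℝ, p l ≤ M) ∧ ContinuousAt p 0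

/-! ### The transform of the noise at time `0` -/

section Noise

variable {Ω : Type*} [MeasurableSpace Ω]

/-- The random variable `W_Φ(0,s)`. -/
def awtNoise (ψ : ℝ → ℂ) (Φ : ℝ → Ω → ℝ) (s : ℝ) (ω : Ω) : ℂ :=
  awt ψ (fun τ => ((Φ τ ω : ℝ) : ℂ)) 0 s

/-- `W` is a version of the process `(W_Φ(0,s))_{s > 0}` with almost surely continuous paths. -/
structure IsContinuousVersion (P : Measure Ω) (ψ : ℝ → ℂ) (Φ : ℝ → Ω → ℝ)
    (W : ℝ → Ω → ℂ) : Prop where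
  ae_eq : ∀ s : ℝ, 0 < s → W s =ᵐ[P] awtNoise ψ Φ s
  continuousOn : ∀ᵐ ω ∂P, ContinuousOn (fun s => W s ω) (Ioi 0)

/-- `E |W_Φ(0,s)|²`. -/
def secondMoment (P : Measure Ω) (ψ : ℝ → ℂ) (Φ : ℝ → Ω → ℝ) (s : ℝ) : ℝ :=
  ∫ ω, ‖awtNoise ψ Φ s ω‖ ^ 2 ∂P

/-- `T` is a threshold beyond which `E |W_Φ(0,s)|² ≤ s^{-h}`. -/
def IsDecayThreshold (P : Measure Ω) (ψ : ℝ → ℂ) (Φ : ℝ → Ω → ℝ) (h T : ℝ) : Prop :=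
  0 < T ∧ ∀ s : ℝ, T ≤ s → secondMoment P ψ Φ s ≤ s ^ (-h)

/-- `𝒟 = 2 ∨ (sup_{s > 0} E |W_Φ(0,s)|²)^{1/2}`. -/
def diamConst (P : Measure Ω) (ψ : ℝ → ℂ) (Φ : ℝ → Ω → ℝ) : ℝ :=
  max 2 (Real.sqrt (⨆ s : Ioi (0 : ℝ), secondMoment P ψ Φ (s : ℝ)))

/-- The Hölder constant `C₂`, computed from `C₁`, `γ`, `ψ̂` and `Var(Φ(0))`. -/
def holderConst (P : Measure Ω) (ψ : ℝ → ℂ) (Φ : ℝ → Ω → ℝ) (γ C₁ : ℝ) : ℝ :=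
  max 1 (Real.sqrt
    (C₁ * (1 / γ + 2 / (2 - γ)) * (2 * supNorm (fourierHat ψ)) ^ (2 - γ)
        * lipConst (fourierHat ψ) ^ γ
      + 2 * supNorm (fourierHat ψ) ^ 2 * Var[Φ 0; P]))

end Noise

/-- The upper bound, as a function of `𝒟`, `γ`, `H⁻`, `C₂` and `T`; for `T < 1` the term `√(ln T)`
is read as `0`. -/
def dudleyBound (D γ h C₂ T : ℝ) : ℝ :=
  4 * (Real.sqrt (Real.log D) * (D ^ 3 / (D - 1) ^ 2) * Real.sqrt (1 / γ + 1 / h)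
    + (Real.sqrt (1 / γ * Real.log C₂) + Real.sqrt (Real.log (max 1 T))) * (D ^ 2 / (D - 1)))

end AWT

end

/-!
Integrating against the wavelet kills the mean of `Φ`, and the spectral representation turns `E
|W_Φ(0,s) - W_Φ(0,t)|²` into `∫ p(λ) |ψ̂(sλ) - ψ̂(tλ)|² dλ`. Since pathwise integrals of a
Gaussian process lie in its closed linear span in `L²`, the increments of `W_Φ(0,·)` have
Gaussian exponential moments governed by this distance. It is extended to `s = 0`, where the
transform vanishes.

Splitting the frequency integral where the Lipschitz bound on `ψ̂` meets the uniform one gives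
`E |W_Φ(0,s) - W_Φ(0,t)|² ≤ C₂² |s - t|^γ`, while the behaviour of `p` at the origin gives `E
|W_Φ(0,s)|² ≤ s^{-h}` for large `s`. Hence at scale `𝒟⁻ᵏ` all large `s` are served by the single
point `0`, and the remaining bounded interval by a grid: the covering numbers of `[0, ∞)` grow
geometrically in `k`. Chaining along these nets sums to the stated bound, and chaining along the
dyadic points gives the continuous version.
-/

open scoped NNReal ENNReal

namespace AWT

section WeightedIntegral

/-- A jointly measurable real process with uniformly bounded second moments. For such a process the
pathwise integral `∫ t, F t ω • g t ∂μ` against an integrable weight `g` is a square integrable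
random variable. -/
structure IsL2BoundedProcess {T Ω : Type*} [MeasurableSpace T] [MeasurableSpace Ω]
    (F : T → Ω → ℝ) (P : Measure Ω) : Prop where
  measurable : Measurable (Function.uncurry F)
  exists_eLpNorm_le : ∃ V : ℝ≥0, ∀ t, eLpNorm (F t) 2 P ≤ V

theorem sq_eLpNorm_two {α E : Type*} [MeasurableSpace α] {μ : Measure α} [NormedAddCommGroup E]
    (f : α → E) : eLpNorm f 2 μ ^ 2 = ∫⁻ x, ‖f x‖ₑ ^ 2 ∂μ := by
  simpa using eLpNorm_nnreal_pow_eq_lintegral (f := f) (μ := μ) (p := 2) two_ne_zero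

theorem sq_lintegral_mul_le {α : Type*} [MeasurableSpace α] {μ : Measure α} {f h : α → ℝ≥0∞}
    (hf : AEMeasurable f μ) (hh : AEMeasurable h μ) :
    (∫⁻ x, f x * h x ∂μ) ^ 2 ≤ (∫⁻ x, f x ∂μ) * ∫⁻ x, f x * h x ^ 2 ∂μ := by
  have hsq : ∀ x : ℝ≥0∞, (x ^ (1 / 2 : ℝ)) ^ 2 = x := fun x => by
    rw [← ENNReal.rpow_natCast, ← ENNReal.rpow_mul]; norm_num
  have hmul : ∀ x y : ℝ≥0∞, x * y = x ^ (1 / 2 : ℝ) * (x ^ (1 / 2 : ℝ) * y) := fun x y => by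
    rw [← mul_assoc, ← sq, hsq]
  calc (∫⁻ x, f x * h x ∂μ) ^ 2
      = (∫⁻ x, f x ^ (1 / 2 : ℝ) * (f x ^ (1 / 2 : ℝ) * h x) ∂μ) ^ 2 := by simp only [← hmul]
    _ ≤ ((∫⁻ x, (f x ^ (1 / 2 : ℝ)) ^ (2 : ℝ) ∂μ) ^ (1 / 2 : ℝ) *
          (∫⁻ x, (f x ^ (1 / 2 : ℝ) * h x) ^ (2 : ℝ) ∂μ) ^ (1 / 2 : ℝ)) ^ 2 := by
        gcongr
        exact ENNReal.lintegral_mul_le_Lp_mul_Lq μ Real.HolderConjugate.two_two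
          (hf.pow_const _) ((hf.pow_const _).mul hh)
    _ = _ := by simp only [mul_pow, hsq, ENNReal.rpow_ofNat]

variable {T Ω 𝕜 : Type*} [MeasurableSpace T] [MeasurableSpace Ω] [RCLike 𝕜] {μ : Measure T}
  {P : Measure Ω} {F : T → Ω → ℝ} {g : T → 𝕜}

namespace IsL2BoundedProcess

theorem memLp (hF : IsL2BoundedProcess F P) (t : T) : MemLp (F t) 2 P :=
  have ⟨_, hV⟩ := hF.exists_eLpNorm_le
  ⟨(hF.measurable.of_uncurry_left (x := t)).aestronglyMeasurable,
    (hV t).trans_lt ENNReal.coe_lt_top⟩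

theorem aestronglyMeasurable_smul [SFinite P] (hF : IsL2BoundedProcess F P)
    (hg : AEStronglyMeasurable g μ) :
    AEStronglyMeasurable (fun q : T × Ω => F q.1 q.2 • g q.1) (μ.prod P) :=
  hF.measurable.aestronglyMeasurable.smul hg.comp_fst

variable [SFinite P]

theorem integrable_prod (hF : IsL2BoundedProcess F P) (hg : Integrable g μ) {Y : Ω → 𝕜}
    (hY : MemLp Y 2 P) :
    Integrable (fun q : T × Ω => (F q.1 q.2 • g q.1) * Y q.2) (μ.prod P) := by
  obtain ⟨V, hV⟩ := hF.exists_eLpNorm_le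
  have hmeas : AEStronglyMeasurable (fun q : T × Ω => (F q.1 q.2 • g q.1) * Y q.2) (μ.prod P) :=
    (hF.aestronglyMeasurable_smul hg.1).mul hY.1.comp_snd
  have hFY : ∀ t, ∫⁻ ω, ‖F t ω • Y ω‖ₑ ∂P ≤ V * eLpNorm Y 2 P := fun t => by
    rw [← eLpNorm_one_eq_lintegral_enorm]
    exact (eLpNorm_smul_le_mul_eLpNorm hY.1 (hF.memLp t).1).trans (mul_left_mono (hV t))
  refine ⟨hmeas, ?_⟩
  calc ∫⁻ q, ‖(F q.1 q.2 • g q.1) * Y q.2‖ₑ ∂μ.prod P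
      = ∫⁻ t, ‖g t‖ₑ * ∫⁻ ω, ‖F t ω • Y ω‖ₑ ∂P ∂μ := by
        rw [lintegral_prod _ hmeas.enorm]
        refine lintegral_congr fun t => ?_
        rw [← lintegral_const_mul' _ _ enorm_ne_top]
        simp only [enorm_mul, enorm_smul, mul_left_comm, mul_assoc]
    _ ≤ ∫⁻ t, ‖g t‖ₑ * (V * eLpNorm Y 2 P) ∂μ := by gcongr with t; exact hFY t
    _ < ⊤ := by
        rw [lintegral_mul_const' _ _ (ENNReal.mul_ne_top ENNReal.coe_ne_top hY.2.ne)]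
        exact ENNReal.mul_lt_top hg.2 (ENNReal.mul_lt_top ENNReal.coe_lt_top hY.2)

theorem integral_integral_mul [SFinite μ] (hF : IsL2BoundedProcess F P) (hg : Integrable g μ)
    {Y : Ω → 𝕜} (hY : MemLp Y 2 P) :
    ∫ ω, (∫ t, F t ω • g t ∂μ) * Y ω ∂P = ∫ t, g t * ∫ ω, F t ω • Y ω ∂P ∂μ := by
  simp only [← integral_mul_const]
  rw [← integral_integral_swap (hF.integrable_prod hg hY)]
  simp only [← integral_const_mul, smul_mul_assoc, mul_smul_comm]

theorem ae_integrable_smul [SFinite μ] [IsFiniteMeasure P] (hF : IsL2BoundedProcess F P)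
    (hg : Integrable g μ) : ∀ᵐ ω ∂P, Integrable (fun t => F t ω • g t) μ := by
  simpa only [mul_one] using (hF.integrable_prod hg (memLp_const (1 : 𝕜))).prod_left_ae

theorem memLp_integral [SFinite μ] (hF : IsL2BoundedProcess F P) (hg : Integrable g μ) :
    MemLp (fun ω => ∫ t, F t ω • g t ∂μ) 2 P := by
  obtain ⟨V, hV⟩ := hF.exists_eLpNorm_le
  have hF2 : ∀ t, ∫⁻ ω, ‖F t ω‖ₑ ^ 2 ∂P ≤ V ^ 2 := fun t => by
    simpa only [sq_eLpNorm_two] using pow_le_pow_left' (hV t) 2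
  have hswap : ∫⁻ ω, ∫⁻ t, ‖g t‖ₑ * ‖F t ω‖ₑ ^ 2 ∂μ ∂P =
      ∫⁻ t, ‖g t‖ₑ * ∫⁻ ω, ‖F t ω‖ₑ ^ 2 ∂P ∂μ := by
    rw [lintegral_lintegral_swap (hg.1.enorm.comp_snd.mul
      ((hF.measurable.comp measurable_swap).enorm.pow_const 2).aemeasurable)]
    simp only [lintegral_const_mul' _ _ enorm_ne_top]
  have hlt : ∫⁻ ω, ‖∫ t, F t ω • g t ∂μ‖ₑ ^ 2 ∂P < ⊤ := calc
    ∫⁻ ω, ‖∫ t, F t ω • g t ∂μ‖ₑ ^ 2 ∂P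
      ≤ ∫⁻ ω, (∫⁻ t, ‖g t‖ₑ * ‖F t ω‖ₑ ∂μ) ^ 2 ∂P := by
        gcongr with ω
        simpa only [enorm_smul, mul_comm] using
          enorm_integral_le_lintegral_enorm fun t => F t ω • g t
    _ ≤ ∫⁻ ω, (∫⁻ t, ‖g t‖ₑ ∂μ) * ∫⁻ t, ‖g t‖ₑ * ‖F t ω‖ₑ ^ 2 ∂μ ∂P := by
        gcongr with ω
        exact sq_lintegral_mul_le hg.1.enorm
          (hF.measurable.of_uncurry_right (y := ω)).enorm.aemeasurable
    _ = (∫⁻ t, ‖g t‖ₑ ∂μ) * ∫⁻ t, ‖g t‖ₑ * ∫⁻ ω, ‖F t ω‖ₑ ^ 2 ∂P ∂μ := by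
        rw [lintegral_const_mul' _ _ hg.2.ne, hswap]
    _ ≤ (∫⁻ t, ‖g t‖ₑ ∂μ) * ∫⁻ t, ‖g t‖ₑ * (V : ℝ≥0∞) ^ 2 ∂μ := by gcongr with t; exact hF2 t
    _ < ⊤ := by
        rw [lintegral_mul_const' _ _ (by finiteness)]
        exact ENNReal.mul_lt_top hg.2 (ENNReal.mul_lt_top hg.2 (by finiteness))
  refine ⟨(hF.aestronglyMeasurable_smul hg.1).prod_swap.integral_prod_right', ?_⟩
  rw [← sq_eLpNorm_two] at hlt
  exact (ENNReal.pow_lt_top_iff.1 hlt).resolve_right two_ne_zero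

end IsL2BoundedProcess

end WeightedIntegral

section Gaussian

variable {T Ω : Type*} [MeasurableSpace Ω] {P : Measure Ω}

theorem isGaussianProcess_sub_const {X : T → Ω → ℝ} (hX : IsGaussianProcess X P) (m : T → ℝ) :
    IsGaussianProcess (fun t ω => X t ω - m t) P where
  hasGaussianLaw I := by
    have hI := hX.hasGaussianLaw I
    have := hI.isGaussian_map
    refine ⟨?_⟩
    have hcomp : (fun ω => I.restrict fun t => X t ω - m t) =
        (fun x => x - I.restrict m) ∘ fun ω => I.restrict fun t => X t ω := rfl
    rw [hcomp, ← AEMeasurable.map_map_of_aemeasurable (by fun_prop) hI.aemeasurable]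
    infer_instance

theorem sq_norm_Lp_two (Z : Lp ℝ 2 P) : ‖Z‖ ^ 2 = ∫ ω, Z ω ^ 2 ∂P := by
  rw [← real_inner_self_eq_norm_sq, L2.inner_def]
  simp [sq]

theorem sq_norm_toLp_le {Z : Ω → ℂ} {X : Ω → ℝ} (hZ : MemLp Z 2 P) (hX : MemLp X 2 P)
    (hXZ : ∀ ω, |X ω| ≤ ‖Z ω‖) : ‖hX.toLp X‖ ^ 2 ≤ ∫ ω, ‖Z ω‖ ^ 2 ∂P := by
  rw [sq_norm_Lp_two, integral_congr_ae (hX.coeFn_toLp.mono fun ω hω => by rw [hω])]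
  refine integral_mono hX.integrable_sq
    ((memLp_two_iff_integrable_sq_norm hZ.1).1 hZ) fun ω => ?_
  exact sq_le_sq' ((neg_le_neg (hXZ ω)).trans (neg_abs_le _)) ((le_abs_self _).trans (hXZ ω))

/-- An element of `L²` which is a centred Gaussian random variable; its variance is then the square
of its norm. -/
def IsCentredGaussian (Z : Lp ℝ 2 P) : Prop :=
  P.map Z = gaussianReal 0 (‖Z‖₊ ^ 2)

theorem isCentredGaussian_of_hasGaussianLaw {Z : Lp ℝ 2 P} (hZ : HasGaussianLaw Z P)
    (hZ0 : ∫ ω, Z ω ∂P = 0) : IsCentredGaussian Z := by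
  have hvar : Var[Z; P].toNNReal = ‖Z‖₊ ^ 2 := by
    rw [variance_of_integral_eq_zero hZ.aemeasurable hZ0, ← sq_norm_Lp_two,
      Real.toNNReal_pow (norm_nonneg _), norm_toNNReal]
  rw [IsCentredGaussian, hZ.map_eq_gaussianReal, hZ0, hvar]

theorem IsCentredGaussian.lintegral_exp_mul_abs_le {Z : Lp ℝ 2 P} (hZ : IsCentredGaussian Z)
    (τ : ℝ) : ∫⁻ ω, ENNReal.ofReal (Real.exp (τ * |Z ω|)) ∂P ≤
      ENNReal.ofReal (2 * Real.exp (‖Z‖ ^ 2 * τ ^ 2 / 2)) := by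
  have hint : ∀ a : ℝ, Integrable (fun ω => Real.exp (a * Z ω)) P := fun a => by
    refine Integrable.comp_aemeasurable (g := fun x => Real.exp (a * x)) ?_
      (Lp.aestronglyMeasurable Z).aemeasurable
    rw [hZ]
    exact integrable_exp_mul_gaussianReal a
  have hmgf : ∀ a : ℝ, ∫ ω, Real.exp (a * Z ω) ∂P = Real.exp (‖Z‖ ^ 2 * a ^ 2 / 2) := fun a => by
    simpa [mgf] using mgf_gaussianReal hZ a
  have hexp : ∀ x : ℝ, Real.exp (τ * |x|) ≤ Real.exp (τ * x) + Real.exp (-τ * x) := fun x => by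
    rcases abs_choice x with h | h <;> rw [h]
    · exact le_add_of_nonneg_right (Real.exp_pos _).le
    · rw [mul_neg, neg_mul]; exact le_add_of_nonneg_left (Real.exp_pos _).le
  calc ∫⁻ ω, ENNReal.ofReal (Real.exp (τ * |Z ω|)) ∂P
      ≤ ∫⁻ ω, ENNReal.ofReal (Real.exp (τ * Z ω) + Real.exp (-τ * Z ω)) ∂P := by
        gcongr with ω; exact hexp _
    _ = ENNReal.ofReal (2 * Real.exp (‖Z‖ ^ 2 * τ ^ 2 / 2)) := by
        rw [← ofReal_integral_eq_lintegral_ofReal ((hint τ).fun_add (hint (-τ)))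
          (ae_of_all _ fun ω => by positivity), integral_add (hint τ) (hint (-τ)), hmgf, hmgf,
          neg_sq, two_mul]

/-- The norm of `Z` has the exponential moments that a centred Gaussian variable in `ℂ` with second
moment `v` has; the factor `4` accounts for both signs of both coordinates. -/
structure HasSubgaussianNorm {E : Type*} [NormedAddCommGroup E] (Z : Ω → E) (v : ℝ)
    (P : Measure Ω) : Prop where
  aestronglyMeasurable : AEStronglyMeasurable Z P
  lintegral_exp_le : ∀ τ : ℝ, 0 ≤ τ →
    ∫⁻ ω, ENNReal.ofReal (Real.exp (τ * ‖Z ω‖)) ∂P ≤ ENNReal.ofReal (4 * Real.exp (τ ^ 2 * v))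

theorem HasSubgaussianNorm.mono {E : Type*} [NormedAddCommGroup E] {Z : Ω → E} {v w : ℝ}
    (hZ : HasSubgaussianNorm Z v P) (hvw : v ≤ w) : HasSubgaussianNorm Z w P where
  aestronglyMeasurable := hZ.aestronglyMeasurable
  lintegral_exp_le τ hτ := (hZ.lintegral_exp_le τ hτ).trans
    (ENNReal.ofReal_le_ofReal (by gcongr))

theorem hasSubgaussianNorm_of_isCentredGaussian {Z : Ω → ℂ} (hZ : MemLp Z 2 P)
    (hre : IsCentredGaussian (hZ.re.toLp _)) (him : IsCentredGaussian (hZ.im.toLp _)) :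
    HasSubgaussianNorm Z (∫ ω, ‖Z ω‖ ^ 2 ∂P) P where
  aestronglyMeasurable := hZ.1
  lintegral_exp_le τ hτ := by
    set v := ∫ ω, ‖Z ω‖ ^ 2 ∂P
    have hcoord : ∀ {X : Ω → ℝ} (hX : MemLp X 2 P), IsCentredGaussian (hX.toLp X) →
        (∀ ω, |X ω| ≤ ‖Z ω‖) → ∫⁻ ω, ENNReal.ofReal (Real.exp (√2 * τ * |X ω|)) ∂P ≤
          ENNReal.ofReal (2 * Real.exp (τ ^ 2 * v)) := fun {X} hX hG hXZ => by
      rw [lintegral_congr_ae (hX.coeFn_toLp.mono fun ω hω => by rw [← hω])]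
      refine (hG.lintegral_exp_mul_abs_le _).trans ?_
      gcongr
      rw [mul_pow, Real.sq_sqrt zero_le_two]
      nlinarith [mul_le_mul_of_nonneg_left (sq_norm_toLp_le hZ hX hXZ) (sq_nonneg τ)]
    have hmax : ∀ z : ℂ, Real.exp (τ * ‖z‖) ≤
        Real.exp (√2 * τ * |z.re|) + Real.exp (√2 * τ * |z.im|) := fun z => by
      have hz := mul_le_mul_of_nonneg_left (Complex.norm_le_sqrt_two_mul_max z) hτ
      rw [mul_left_comm, ← mul_assoc] at hz
      rcases max_choice |z.re| |z.im| with h | h <;> rw [h] at hz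
      · exact (Real.exp_le_exp.2 hz).trans (le_add_of_nonneg_right (Real.exp_pos _).le)
      · exact (Real.exp_le_exp.2 hz).trans (le_add_of_nonneg_left (Real.exp_pos _).le)
    calc ∫⁻ ω, ENNReal.ofReal (Real.exp (τ * ‖Z ω‖)) ∂P
        ≤ ∫⁻ ω, ENNReal.ofReal (Real.exp (√2 * τ * |(Z ω).re|)) +
            ENNReal.ofReal (Real.exp (√2 * τ * |(Z ω).im|)) ∂P := by
          gcongr with ω
          rw [← ENNReal.ofReal_add (Real.exp_pos _).le (Real.exp_pos _).le]
          exact ENNReal.ofReal_le_ofReal (hmax _)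
      _ ≤ ENNReal.ofReal (2 * Real.exp (τ ^ 2 * v)) +
            ENNReal.ofReal (2 * Real.exp (τ ^ 2 * v)) := by
          have hre_meas : AEMeasurable (fun ω => (Z ω).re) P := hZ.re.1.aemeasurable
          rw [lintegral_add_left' (hre_meas.abs.const_mul _).exp.ennreal_ofReal]
          gcongr
          exacts [hcoord hZ.re hre fun ω => Complex.abs_re_le_norm _,
            hcoord hZ.im him fun ω => Complex.abs_im_le_norm _]
      _ = ENNReal.ofReal (4 * Real.exp (τ ^ 2 * v)) := by
          rw [← ENNReal.ofReal_add (by positivity) (by positivity)]; ring_nf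

variable [IsProbabilityMeasure P]

theorem isCentredGaussian_iff_charFun {Z : Lp ℝ 2 P} : IsCentredGaussian Z ↔
    ∀ t : ℝ, charFun (P.map Z) t = Complex.exp (-((‖Z‖ ^ 2 * t ^ 2 / 2 : ℝ) : ℂ)) := by
  have := Measure.isProbabilityMeasure_map (μ := P) (Lp.aestronglyMeasurable Z).aemeasurable
  have hchar : ∀ t : ℝ, charFun (gaussianReal 0 (‖Z‖₊ ^ 2)) t =
      Complex.exp (-((‖Z‖ ^ 2 * t ^ 2 / 2 : ℝ) : ℂ)) := fun t => by
    rw [charFun_gaussianReal]; congr 1; push_cast; simp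
  refine ⟨fun h t => by rw [h, hchar], fun h => Measure.ext_of_charFun ?_⟩
  ext t
  rw [h, hchar]

theorem isClosed_isCentredGaussian : IsClosed {Z : Lp ℝ 2 P | IsCentredGaussian Z} := by
  refine IsSeqClosed.isClosed fun u Z hu huZ => isCentredGaussian_iff_charFun.2 fun t => ?_
  have hlaw := (tendstoInMeasure_of_tendsto_Lp huZ).tendstoInDistribution
    fun n => (Lp.aestronglyMeasurable (u n)).aemeasurable
  have hchar := ProbabilityMeasure.tendsto_iff_tendsto_charFun.1 hlaw.tendsto t
  refine tendsto_nhds_unique hchar (Tendsto.congr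
    (fun n => (isCentredGaussian_iff_charFun.1 (hu n) t).symm) ?_)
  have hcont : Continuous fun Y : Lp ℝ 2 P =>
      Complex.exp (-((‖Y‖ ^ 2 * t ^ 2 / 2 : ℝ) : ℂ)) := by fun_prop
  exact (hcont.tendsto Z).comp huZ

variable {F : T → Ω → ℝ}

theorem isCentredGaussian_of_mem_span (hF : IsGaussianProcess F P) (hF0 : ∀ t, ∫ ω, F t ω ∂P = 0)
    (hF2 : ∀ t, MemLp (F t) 2 P) {Z : Lp ℝ 2 P}
    (hZ : Z ∈ Submodule.span ℝ (range fun t => (hF2 t).toLp (F t))) : IsCentredGaussian Z := by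
  obtain ⟨c, rfl⟩ := Finsupp.mem_span_range_iff_exists_finsupp.1 hZ
  have hae : ⇑(c.sum fun t a => a • (hF2 t).toLp (F t)) =ᵐ[P]
      fun ω => ∑ t ∈ c.support, (c t • F t) ω := by
    refine (Lp.coeFn_fun_finsetSum _ _).trans ?_
    have hterm : ∀ᵐ ω ∂P, ∀ t ∈ c.support,
        (c t • (hF2 t).toLp (F t) : Lp ℝ 2 P) ω = (c t • F t) ω :=
      (ae_ball_iff c.support.countable_toSet).2 fun t _ =>
        ((hF2 t).const_smul (c t)).coeFn_toLp
    filter_upwards [hterm] with ω hω using Finset.sum_congr rfl hω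
  refine isCentredGaussian_of_hasGaussianLaw
    (((hF.smul c).hasGaussianLaw_fun_sum (I := c.support)).congr hae.symm) ?_
  rw [integral_congr_ae hae, integral_finsetSum _ fun t _ =>
    (((hF2 t).const_smul (c t)).integrable one_le_two : Integrable (c t • F t) P)]
  simp [integral_const_mul, hF0]

theorem isCentredGaussian_integral [MeasurableSpace T] {μ : Measure T} [SFinite μ]
    (hF : IsGaussianProcess F P) (hF0 : ∀ t, ∫ ω, F t ω ∂P = 0) (hFb : IsL2BoundedProcess F P)
    {g : T → ℝ} (hg : Integrable g μ) :
    IsCentredGaussian ((hFb.memLp_integral hg).toLp _) := by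
  set K := Submodule.span ℝ (range fun t => (hFb.memLp t).toLp (F t))
  suffices hmem : (hFb.memLp_integral hg).toLp _ ∈ K.topologicalClosure from
    closure_minimal (fun Y hY => isCentredGaussian_of_mem_span hF hF0 hFb.memLp hY)
      isClosed_isCentredGaussian hmem
  rw [← Submodule.orthogonal_orthogonal_eq_closure, Submodule.mem_orthogonal]
  intro Y hY
  have hYF : ∀ t, ∫ ω, F t ω • Y ω ∂P = 0 := fun t => by
    rw [← (Submodule.mem_orthogonal' K Y).1 hY _ (Submodule.subset_span ⟨t, rfl⟩), L2.inner_def]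
    refine integral_congr_ae ?_
    filter_upwards [(hFb.memLp t).coeFn_toLp] with ω hω
    rw [hω, Real.inner_apply, smul_eq_mul, mul_comm]
  rw [L2.inner_def]
  calc ∫ ω, inner ℝ (Y ω) ((hFb.memLp_integral hg).toLp _ ω) ∂P
      = ∫ ω, (∫ t, F t ω • g t ∂μ) * Y ω ∂P := by
        refine integral_congr_ae ?_
        filter_upwards [(hFb.memLp_integral hg).coeFn_toLp] with ω hω
        rw [hω, Real.inner_apply, mul_comm]
    _ = 0 := by
        rw [hFb.integral_integral_mul hg (Lp.memLp Y)]
        simp only [hYF, mul_zero, integral_zero]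

theorem hasSubgaussianNorm_integral [MeasurableSpace T] {μ : Measure T} [SFinite μ]
    (hF : IsGaussianProcess F P) (hF0 : ∀ t, ∫ ω, F t ω ∂P = 0) (hFb : IsL2BoundedProcess F P)
    {g : T → ℂ} (hg : Integrable g μ) :
    HasSubgaussianNorm (fun ω => ∫ t, F t ω • g t ∂μ) (∫ ω, ‖∫ t, F t ω • g t ∂μ‖ ^ 2 ∂P) P := by
  have hcoord : ∀ L : ℂ →L[ℝ] ℝ, ∀ {X : Ω → ℝ} (hX : MemLp X 2 P),
      (∀ ω, X ω = L (∫ t, F t ω • g t ∂μ)) → IsCentredGaussian (hX.toLp X) := by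
    intro L X hX hXL
    convert isCentredGaussian_integral hF hF0 hFb (L.integrable_comp hg) using 1
    refine (MemLp.toLp_eq_toLp_iff _ _).2 ?_
    filter_upwards [hFb.ae_integrable_smul hg] with ω hω
    rw [hXL, ← L.integral_comp_comm hω]
    simp only [map_smul]
  exact hasSubgaussianNorm_of_isCentredGaussian (hFb.memLp_integral hg)
    (hcoord Complex.reCLM _ fun _ => rfl) (hcoord Complex.imCLM _ fun _ => rfl)

end Gaussian

section FourierTransform

open FourierTransform SchwartzMap in
theorem memLp_two_fourier {V E : Type*} [NormedAddCommGroup V] [InnerProductSpace ℝ V]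
    [FiniteDimensional ℝ V] [MeasurableSpace V] [BorelSpace V] [NormedAddCommGroup E]
    [InnerProductSpace ℂ E] [CompleteSpace E] {f : V → E} (hf : Integrable f) (hf2 : MemLp f 2) :
    MemLp (𝓕 f) 2 := by
  set L : Lp E 2 (volume : Measure V) := hf2.toLp f with hL
  suffices h : (𝓕 L : Lp E 2 (volume : Measure V)) =ᵐ[volume] 𝓕 f from
    (memLp_congr_ae h).1 (Lp.memLp (𝓕 L))
  have hcont : Continuous (𝓕 f) :=
    VectorFourier.fourierIntegral_continuous Real.continuous_fourierChar
      (by exact continuous_inner) hf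
  refine ae_eq_of_integral_contDiff_smul_eq
    ((Lp.memLp (𝓕 L)).locallyIntegrable one_le_two) hcont.locallyIntegrable fun g hg hgs => ?_
  have hgs' : HasCompactSupport (Complex.ofRealCLM ∘ g) := hgs.comp_left rfl
  let φ : 𝓢(V, ℂ) := hgs'.toSchwartzMap (Complex.ofRealCLM.contDiff.comp hg)
  have hφ : ∀ (x : V) (y : E), φ x • y = g x • y := fun x y =>
    (RCLike.real_smul_eq_coe_smul (g x) y).symm
  have hpair : ∫ x, φ x • (𝓕 L : Lp E 2 (volume : Measure V)) x = ∫ x, φ x • (𝓕 f) x := calc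
    ∫ x, φ x • (𝓕 L : Lp E 2 (volume : Measure V)) x
      = ∫ x, (𝓕 φ) x • L x := by
        simpa only [TemperedDistribution.fourier_apply, Lp.toTemperedDistribution_apply] using
          congrArg (fun S => S φ) (Lp.fourier_toTemperedDistribution_eq L).symm
    _ = ∫ x, (𝓕 φ) x • f x :=
        integral_congr_ae (hf2.coeFn_toLp.mono fun x hx => by simp only [hL, hx])
    _ = ∫ x, φ x • (𝓕 f) x := by
        have hflip := VectorFourier.integral_fourierIntegral_smul_eq_flip (L := innerₗ V)
          (μ := volume) (ν := volume) (f := φ) (g := f) Real.continuous_fourierChar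
          (by exact continuous_inner) φ.integrable hf
        rwa [flip_innerₗ] at hflip
  simpa only [hφ] using hpair

variable {f g : ℝ → ℂ}

theorem fourierHat_eq_fourierIntegral (f : ℝ → ℂ) : fourierHat f =
    VectorFourier.fourierIntegral Real.probChar volume (LinearMap.mul ℝ ℝ) f := by
  ext w
  rw [fourierHat, VectorFourier.fourierIntegral_probChar]
  simp only [LinearMap.mul_apply', smul_eq_mul]
  congr! 4 with t
  push_cast
  ring

theorem fourierHat_eq_fourier (f : ℝ → ℂ) (w : ℝ) :
    fourierHat f w = FourierTransform.fourier f (w / (2 * Real.pi)) := by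
  rw [Real.fourier_eq', fourierHat]
  congr! 4 with t
  have : (Real.pi : ℂ) ≠ 0 := by exact_mod_cast Real.pi_ne_zero
  simp only [RCLike.inner_apply, conj_trivial]
  push_cast
  field_simp

theorem norm_fourierHat_le_integral_norm (f : ℝ → ℂ) (w : ℝ) : ‖fourierHat f w‖ ≤ ∫ t, ‖f t‖ := by
  rw [fourierHat_eq_fourierIntegral]
  exact VectorFourier.norm_fourierIntegral_le_integral_norm _ _ _ _ _

theorem continuous_fourierHat (hf : Integrable f) : Continuous (fourierHat f) := by
  rw [fourierHat_eq_fourierIntegral]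
  exact VectorFourier.fourierIntegral_continuous Real.continuous_probChar continuous_mul hf

theorem integrable_exp_mul (hf : Integrable f) (w : ℝ) :
    Integrable fun t : ℝ => Complex.exp (-(Complex.I * (t : ℂ) * (w : ℂ))) * f t := by
  refine hf.bdd_mul (c := 1) (Continuous.aestronglyMeasurable (by fun_prop))
    (ae_of_all _ fun t => ?_)
  simp [Complex.norm_exp]

theorem fourierHat_sub (hf : Integrable f) (hg : Integrable g) (w : ℝ) :
    fourierHat (f - g) w = fourierHat f w - fourierHat g w := by
  simp only [fourierHat, Pi.sub_apply, mul_sub]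
  exact integral_sub (integrable_exp_mul hf w) (integrable_exp_mul hg w)

theorem integral_mul_fourierHat (hf : Integrable f) (hg : Integrable g) :
    ∫ t, f t * fourierHat g t = ∫ w, g w * fourierHat f w := by
  have hflip := VectorFourier.integral_fourierIntegral_smul_eq_flip (L := LinearMap.mul ℝ ℝ)
    Real.continuous_probChar continuous_mul hf hg
  have hmul : (LinearMap.mul ℝ ℝ).flip = LinearMap.mul ℝ ℝ := by ext; simp
  simp only [hmul, ← fourierHat_eq_fourierIntegral, smul_eq_mul] at hflip
  simpa only [mul_comm] using hflip.symm

theorem integrable_sq_norm_fourierHat (hf : Integrable f) (hf2 : MemLp f 2) :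
    Integrable fun w => ‖fourierHat f w‖ ^ 2 := by
  have hfourier := memLp_two_fourier hf hf2
  simpa only [fourierHat_eq_fourier] using
    ((memLp_two_iff_integrable_sq_norm hfourier.1).1 hfourier).comp_div (R := 2 * Real.pi)
      (by positivity)

theorem norm_fourierHat_le_supNorm (f : ℝ → ℂ) (w : ℝ) :
    ‖fourierHat f w‖ ≤ supNorm (fourierHat f) :=
  le_ciSup (f := fun x => ‖fourierHat f x‖)
    ⟨∫ t, ‖f t‖, forall_mem_range.2 (norm_fourierHat_le_integral_norm f)⟩ w

/-- The kernel `τ ↦ s⁻¹ ψ(τ/s)`, which for `s = 0` is `0` because `0⁻¹ = 0`. -/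
noncomputable def dilation (ψ : ℝ → ℂ) (s τ : ℝ) : ℂ := s⁻¹ • ψ (τ / s)

theorem integrable_dilation (hf : Integrable f) (s : ℝ) : Integrable (dilation f s) := by
  rcases eq_or_ne s 0 with rfl | hs
  · have hzero : dilation f 0 = 0 := by ext τ; simp [dilation]
    simp [hzero]
  · exact (hf.comp_div hs).smul s⁻¹

theorem fourierHat_dilation (hf0 : fourierHat f 0 = 0) {s : ℝ} (hs : 0 ≤ s) (w : ℝ) :
    fourierHat (dilation f s) w = fourierHat f (s * w) := by
  rcases hs.eq_or_lt with rfl | hs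
  · rw [zero_mul, hf0]
    simp [fourierHat, dilation]
  have hscale := Measure.integral_comp_div
    (fun t : ℝ => Complex.exp (-(Complex.I * (t : ℂ) * ((s * w : ℝ) : ℂ))) * f t) s
  rw [abs_of_pos hs] at hscale
  simp only [fourierHat]
  rw [← inv_smul_smul₀ hs.ne' (∫ t, _ * f t), ← hscale, ← integral_smul]
  have hsw : ∀ t : ℝ, Complex.I * ((t / s : ℝ) : ℂ) * ((s * w : ℝ) : ℂ) = Complex.I * t * w :=
    fun t => by
      have : (s : ℂ) ≠ 0 := by exact_mod_cast hs.ne'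
      push_cast
      field_simp
  simp only [hsw, dilation, mul_smul_comm]

end FourierTransform

section Noise

theorem awtNoise_zero {Ω : Type*} (ψ : ℝ → ℂ) (Φ : ℝ → Ω → ℝ) : awtNoise ψ Φ 0 = 0 := by
  ext ω
  simp [awtNoise, awt]

variable {Ω : Type*} [MeasurableSpace Ω] {P : Measure Ω} {Φ : ℝ → Ω → ℝ} {p : ℝ → ℝ}
  {ψ g : ℝ → ℂ} {s t : ℝ}

/-- The process `Φ - E Φ`. -/
noncomputable def centred (P : Measure Ω) (Φ : ℝ → Ω → ℝ) (t : ℝ) (ω : Ω) : ℝ :=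
  Φ t ω - P[Φ t]

namespace IsGaussianNoise

theorem memLp_two (hΦ : IsGaussianNoise P Φ p) (t : ℝ) : MemLp (Φ t) 2 P :=
  (hΦ.gaussian.hasGaussianLaw_eval t).memLp_two

theorem mean_eq (hΦ : IsGaussianNoise P Φ p) (t : ℝ) : P[Φ t] = P[Φ 0] := by
  simpa [Function.comp_def] using
    ((hΦ.stationary t 1 fun _ => 0).comp (measurable_pi_apply 0)).integral_eq

theorem covariance_eq_sub (hΦ : IsGaussianNoise P Φ p) (s t : ℝ) :
    cov[Φ s, Φ t; P] = cov[Φ (s - t), Φ 0; P] := by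
  have hmeas : Measurable fun x : Fin 2 → ℝ => (x 0 - P[Φ 0]) * (x 1 - P[Φ 0]) := by fun_prop
  have hshift := ((hΦ.stationary t 2 ![s - t, 0]).comp hmeas).integral_eq
  simp only [Function.comp_def, Matrix.cons_val_zero, Matrix.cons_val_one, sub_add_cancel,
    zero_add] at hshift
  simpa only [covariance, hΦ.mean_eq s, hΦ.mean_eq t, hΦ.mean_eq (s - t)] using hshift

theorem integral_centred_mul_centred (hΦ : IsGaussianNoise P Φ p) (s t : ℝ) :
    ∫ ω, centred P Φ s ω • (centred P Φ t ω : ℂ) ∂P =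
      fourierHat (fun l => Complex.exp (Complex.I * t * l) * p l) s := by
  have hcov : ∫ ω, centred P Φ s ω • (centred P Φ t ω : ℂ) ∂P = (cov[Φ t, Φ s; P] : ℂ) := by
    rw [covariance, ← integral_complex_ofReal]
    simp only [centred, Complex.real_smul, Complex.ofReal_mul, mul_comm]
  rw [hcov, hΦ.covariance_eq_sub, hΦ.covariance_eq, fourierHat]
  congr! 2 with l
  rw [← mul_assoc, ← Complex.exp_add]
  congr 2
  push_cast
  ring

theorem isGaussianProcess_centred (hΦ : IsGaussianNoise P Φ p) :
    IsGaussianProcess (centred P Φ) P :=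
  isGaussianProcess_sub_const hΦ.gaussian _

variable [IsProbabilityMeasure P]

theorem integral_centred (hΦ : IsGaussianNoise P Φ p) (t : ℝ) : P[centred P Φ t] = 0 := by
  simp [centred, integral_sub ((hΦ.memLp_two t).integrable one_le_two) (integrable_const _)]

theorem isL2BoundedProcess_centred (hΦ : IsGaussianNoise P Φ p)
    (hm : Measurable (Function.uncurry Φ)) : IsL2BoundedProcess (centred P Φ) P where
  measurable := by
    simp only [Function.uncurry_def, centred, hΦ.mean_eq]
    exact hm.sub_const _
  exists_eLpNorm_le := by
    have h0 : MemLp (centred P Φ 0) 2 P := (hΦ.memLp_two 0).sub (memLp_const _)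
    refine ⟨(eLpNorm (centred P Φ 0) 2 P).toNNReal, fun t => ?_⟩
    rw [ENNReal.coe_toNNReal h0.eLpNorm_ne_top]
    have hlaw : IdentDistrib (centred P Φ t) (centred P Φ 0) P P := by
      have hcentred : ∀ u, centred P Φ u = fun ω => Φ u ω - P[Φ 0] := fun u => by
        ext ω
        rw [centred, hΦ.mean_eq]
      rw [hcentred, hcentred]
      simpa [Function.comp_def] using
        ((hΦ.stationary t 1 fun _ => 0).comp (measurable_pi_apply 0)).sub_const P[Φ 0]
    exact (hlaw.eLpNorm_eq 2).le

theorem integral_integral_smul_mul_centred (hΦ : IsGaussianNoise P Φ p)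
    (hm : Measurable (Function.uncurry Φ)) (hg : Integrable g) (t : ℝ) :
    ∫ ω, (∫ u, centred P Φ u ω • g u) * (centred P Φ t ω : ℂ) ∂P =
      ∫ l : ℝ, Complex.exp (Complex.I * t * l) * p l * fourierHat g l := by
  have hF := hΦ.isL2BoundedProcess_centred hm
  have hY : MemLp (fun ω => (centred P Φ t ω : ℂ)) 2 P := (hF.memLp t).ofReal
  rw [hF.integral_integral_mul hg hY]
  simp only [hΦ.integral_centred_mul_centred]
  refine integral_mul_fourierHat hg (hΦ.density_integrable.ofReal.bdd_mul (c := 1)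
    (Continuous.aestronglyMeasurable (by fun_prop)) (ae_of_all _ fun l => ?_))
  simp [Complex.norm_exp]

theorem integral_norm_integral_smul_sq (hΦ : IsGaussianNoise P Φ p)
    (hm : Measurable (Function.uncurry Φ)) (hg : Integrable g) :
    ∫ ω, ‖∫ t, centred P Φ t ω • g t‖ ^ 2 ∂P = ∫ l, p l * ‖fourierHat g l‖ ^ 2 := by
  have hF := hΦ.isL2BoundedProcess_centred hm
  set X : Ω → ℂ := fun ω => ∫ t, centred P Φ t ω • g t
  set b : ℝ → ℂ := fun l => p l * starRingEnd ℂ (fourierHat g l)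
  have hb : Integrable b := hΦ.density_integrable.ofReal.mul_bdd (c := ∫ t, ‖g t‖)
    (Complex.continuous_conj.comp (continuous_fourierHat hg)).aestronglyMeasurable
    (ae_of_all _ fun l => by simpa using norm_fourierHat_le_integral_norm g l)
  have hcov : ∀ t, ∫ ω, centred P Φ t ω • starRingEnd ℂ (X ω) ∂P = fourierHat b t := fun t => by
    have hconj := congrArg (starRingEnd ℂ) (hΦ.integral_integral_smul_mul_centred hm hg t)
    rw [← integral_conj, ← integral_conj] at hconj
    simpa [fourierHat, b, X, ← Complex.exp_conj, mul_assoc, mul_comm, mul_left_comm] using hconj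
  have hX := hF.integral_integral_mul hg (hF.memLp_integral hg).star
  simp only [Pi.star_apply, RCLike.star_def] at hX
  rw [← Complex.ofReal_inj, ← integral_complex_ofReal, ← integral_complex_ofReal]
  calc ∫ ω, ((‖X ω‖ ^ 2 : ℝ) : ℂ) ∂P
      = ∫ ω, X ω * starRingEnd ℂ (X ω) ∂P := by
        simp only [Complex.mul_conj, Complex.normSq_eq_norm_sq]
    _ = ∫ t, g t * fourierHat b t := by simp only [← hcov]; exact hX
    _ = ∫ l, b l * fourierHat g l := integral_mul_fourierHat hg hb
    _ = ∫ l, ((p l * ‖fourierHat g l‖ ^ 2 : ℝ) : ℂ) := by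
        simp only [b, mul_assoc, Complex.conj_mul', Complex.ofReal_mul, Complex.ofReal_pow]

end IsGaussianNoise

theorem integral_dilation (hψ : IsAnalyticWavelet ψ) (hs : 0 ≤ s) : ∫ τ, dilation ψ s τ = 0 := by
  have h0 := hψ.fourierHat_eq_zero 0 le_rfl
  have hdil := fourierHat_dilation h0 hs 0
  rw [mul_zero, h0] at hdil
  simpa [fourierHat] using hdil

/-- The squared canonical distance `E |W_Φ(0,s) - W_Φ(0,t)|²`, in its spectral form. -/
noncomputable def distSq (p : ℝ → ℝ) (ψ : ℝ → ℂ) (s t : ℝ) : ℝ :=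
  ∫ l, p l * ‖fourierHat ψ (s * l) - fourierHat ψ (t * l)‖ ^ 2

variable [IsProbabilityMeasure P]

theorem awtNoise_ae_eq_conj_integral (hΦ : IsGaussianNoise P Φ p)
    (hm : Measurable (Function.uncurry Φ)) (hψ : IsAnalyticWavelet ψ) (hs : 0 ≤ s) :
    awtNoise ψ Φ s =ᵐ[P] fun ω => starRingEnd ℂ (∫ τ, centred P Φ τ ω • dilation ψ s τ) := by
  have hk := integrable_dilation hψ.integrable s
  set m := ∫ ω, Φ 0 ω ∂P with hm_def
  have hmean : Integrable fun τ => m • dilation ψ s τ := hk.fun_smul m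
  filter_upwards [(hΦ.isL2BoundedProcess_centred hm).ae_integrable_smul hk] with ω hω
  calc awtNoise ψ Φ s ω
      = starRingEnd ℂ (∫ τ, Φ τ ω • dilation ψ s τ) := by
        rw [← integral_conj]
        simp [awtNoise, awt, dilation, mul_assoc]
    _ = starRingEnd ℂ (∫ τ, (centred P Φ τ ω • dilation ψ s τ + m • dilation ψ s τ)) := by
        simp only [← add_smul, centred, hΦ.mean_eq, ← hm_def, sub_add_cancel]
    _ = starRingEnd ℂ (∫ τ, centred P Φ τ ω • dilation ψ s τ) := by
        rw [integral_add hω hmean, integral_smul, integral_dilation hψ hs, smul_zero, add_zero]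

theorem awtNoise_sub_ae_eq_conj_integral (hΦ : IsGaussianNoise P Φ p)
    (hm : Measurable (Function.uncurry Φ)) (hψ : IsAnalyticWavelet ψ) (hs : 0 ≤ s) (ht : 0 ≤ t) :
    awtNoise ψ Φ s - awtNoise ψ Φ t =ᵐ[P] fun ω =>
      starRingEnd ℂ (∫ τ, centred P Φ τ ω • (dilation ψ s - dilation ψ t) τ) := by
  have hint := fun u => (hΦ.isL2BoundedProcess_centred hm).ae_integrable_smul
    (integrable_dilation hψ.integrable u)
  filter_upwards [awtNoise_ae_eq_conj_integral hΦ hm hψ hs,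
    awtNoise_ae_eq_conj_integral hΦ hm hψ ht, hint s, hint t] with ω hs ht hints hintt
  simp only [Pi.sub_apply, smul_sub]
  rw [hs, ht, integral_sub hints hintt, map_sub]

theorem integral_norm_awtNoise_sub_sq (hΦ : IsGaussianNoise P Φ p)
    (hm : Measurable (Function.uncurry Φ)) (hψ : IsAnalyticWavelet ψ) (hs : 0 ≤ s) (ht : 0 ≤ t) :
    ∫ ω, ‖(awtNoise ψ Φ s - awtNoise ψ Φ t) ω‖ ^ 2 ∂P = distSq p ψ s t := by
  have h0 := hψ.fourierHat_eq_zero 0 le_rfl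
  have hint := integrable_dilation hψ.integrable
  have hisometry := hΦ.integral_norm_integral_smul_sq hm ((hint s).sub (hint t))
  simp only [fourierHat_sub (hint s) (hint t), fourierHat_dilation h0 hs,
    fourierHat_dilation h0 ht] at hisometry
  rw [distSq, ← hisometry]
  refine integral_congr_ae ?_
  filter_upwards [awtNoise_sub_ae_eq_conj_integral hΦ hm hψ hs ht] with ω hω
  rw [hω, RCLike.norm_conj]

theorem secondMoment_eq_distSq (hΦ : IsGaussianNoise P Φ p)
    (hm : Measurable (Function.uncurry Φ)) (hψ : IsAnalyticWavelet ψ) (hs : 0 ≤ s) :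
    secondMoment P ψ Φ s = distSq p ψ s 0 := by
  simpa [secondMoment, awtNoise_zero] using
    integral_norm_awtNoise_sub_sq hΦ hm hψ hs le_rfl

theorem hasSubgaussianNorm_awtNoise_sub (hΦ : IsGaussianNoise P Φ p)
    (hm : Measurable (Function.uncurry Φ)) (hψ : IsAnalyticWavelet ψ) (hs : 0 ≤ s) (ht : 0 ≤ t) :
    HasSubgaussianNorm (awtNoise ψ Φ s - awtNoise ψ Φ t) (distSq p ψ s t) P := by
  have hint := integrable_dilation hψ.integrable
  have hsub := hasSubgaussianNorm_integral hΦ.isGaussianProcess_centred hΦ.integral_centred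
    (hΦ.isL2BoundedProcess_centred hm) ((hint s).sub (hint t))
  have hae := awtNoise_sub_ae_eq_conj_integral hΦ hm hψ hs ht
  rw [← integral_norm_awtNoise_sub_sq hΦ hm hψ hs ht]
  have hnorm : ∀ᵐ ω ∂P, ‖(awtNoise ψ Φ s - awtNoise ψ Φ t) ω‖ =
      ‖∫ τ, centred P Φ τ ω • (dilation ψ s - dilation ψ t) τ‖ :=
    hae.mono fun ω hω => by rw [hω, RCLike.norm_conj]
  refine ⟨(Complex.continuous_conj.comp_aestronglyMeasurable hsub.1).congr hae.symm,
    fun τ hτ => ?_⟩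
  rw [integral_congr_ae (hnorm.mono fun ω hω => by rw [hω]),
    lintegral_congr_ae (hnorm.mono fun ω hω => by rw [hω])]
  exact hsub.lintegral_exp_le τ hτ

end Noise

section Increments

theorem supNorm_nonneg (g : ℝ → ℂ) : 0 ≤ supNorm g := Real.iSup_nonneg fun _ => norm_nonneg _

theorem lipConst_nonneg (g : ℝ → ℂ) : 0 ≤ lipConst g := Real.iSup_nonneg fun _ => by positivity

theorem norm_sub_le_lipConst_mul {g : ℝ → ℂ} (hg : ∃ K : ℝ≥0, LipschitzOnWith K g (Ici 0))
    {x y : ℝ} (hx : 0 ≤ x) (hy : 0 ≤ y) : ‖g x - g y‖ ≤ lipConst g * |x - y| := by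
  obtain ⟨K, hK⟩ := hg
  rcases eq_or_ne x y with rfl | hxy
  · simp
  rw [← div_le_iff₀ (abs_pos.2 (sub_ne_zero.2 hxy))]
  refine le_ciSup (f := fun q : Ici (0 : ℝ) × Ici (0 : ℝ) =>
    ‖g (q.1 : ℝ) - g (q.2 : ℝ)‖ / |(q.1 : ℝ) - (q.2 : ℝ)|) ⟨K, ?_⟩ (⟨x, hx⟩, ⟨y, hy⟩)
  rintro _ ⟨q, rfl⟩
  refine div_le_of_le_mul₀ (abs_nonneg _) K.coe_nonneg ?_
  simpa only [dist_eq_norm, Real.norm_eq_abs] using hK.dist_le_mul _ q.1.2 _ q.2.2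

theorem norm_fourierHat_sub_le_supNorm (ψ : ℝ → ℂ) (v w : ℝ) :
    ‖fourierHat ψ v - fourierHat ψ w‖ ≤ 2 * supNorm (fourierHat ψ) :=
  (norm_sub_le _ _).trans ((add_le_add (norm_fourierHat_le_supNorm ψ v)
    (norm_fourierHat_le_supNorm ψ w)).trans_eq (two_mul _).symm)

theorem sq_mul_div_rpow_two_sub {N q : ℝ} (hN : 0 ≤ N) (hq : 0 < q) (γ : ℝ) :
    q ^ 2 * (N / q) ^ (2 - γ) = N ^ (2 - γ) * q ^ γ := by
  have hq2 : q ^ 2 = q ^ γ * q ^ (2 - γ) := by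
    rw [← Real.rpow_add hq, add_sub_cancel, Real.rpow_two]
  rw [hq2, Real.div_rpow hN hq.le]
  field_simp

theorem sq_mul_div_rpow_neg {N q : ℝ} (hN : 0 < N) (hq : 0 ≤ q) (γ : ℝ) :
    N ^ 2 * (N / q) ^ (-γ) = N ^ (2 - γ) * q ^ γ := by
  rw [Real.div_rpow hN.le hq, Real.rpow_neg hq, div_inv_eq_mul, ← mul_assoc, ← Real.rpow_two,
    ← Real.rpow_add hN, sub_eq_add_neg]

-- The two bounds cross at the cutoff `N / q`, up to which the first one is integrated.
theorem setIntegral_Ioi_le_of_le_rpow {f : ℝ → ℝ} {γ C N q : ℝ} (hγ : 0 < γ) (hγ2 : γ < 2)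
    (hC : 0 ≤ C) (hN : 0 ≤ N) (hq : 0 ≤ q) (hf : IntegrableOn f (Ioi 0))
    (hlow : ∀ l, 0 < l → f l ≤ C * q ^ 2 * l ^ (1 - γ))
    (hhigh : ∀ l, 0 < l → f l ≤ C * N ^ 2 * l ^ (-(1 + γ))) :
    ∫ l in Ioi 0, f l ≤ C * (1 / γ + 1 / (2 - γ)) * (N ^ (2 - γ) * q ^ γ) := by
  have hγ2' : 0 < 2 - γ := sub_pos.2 hγ2
  rcases hN.eq_or_lt with rfl | hN
  · refine (setIntegral_nonpos measurableSet_Ioi fun l hl => ?_).trans (by positivity)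
    simpa using hhigh l hl
  rcases hq.eq_or_lt with rfl | hq
  · refine (setIntegral_nonpos measurableSet_Ioi fun l hl => ?_).trans (by positivity)
    simpa using hlow l hl
  have hA : 0 < N / q := by positivity
  have hbelow : ∫ l in Ioc 0 (N / q), f l ≤ C * (1 / (2 - γ)) * (N ^ (2 - γ) * q ^ γ) := calc
    _ ≤ ∫ l in Ioc 0 (N / q), C * q ^ 2 * l ^ (1 - γ) :=
      setIntegral_mono_on (hf.mono_set Ioc_subset_Ioi_self)
        ((intervalIntegral.intervalIntegrable_rpow' (by linarith)).1.const_mul _)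
        measurableSet_Ioc fun l hl => hlow l hl.1
    _ = C * (1 / (2 - γ)) * (q ^ 2 * (N / q) ^ (2 - γ)) := by
      rw [integral_const_mul, ← intervalIntegral.integral_of_le hA.le,
        integral_rpow (Or.inl (by linarith)), show 1 - γ + 1 = 2 - γ by ring,
        Real.zero_rpow hγ2'.ne', sub_zero]
      ring
    _ = _ := by rw [sq_mul_div_rpow_two_sub hN.le hq]
  have habove : ∫ l in Ioi (N / q), f l ≤ C * (1 / γ) * (N ^ (2 - γ) * q ^ γ) := calc
    _ ≤ ∫ l in Ioi (N / q), C * N ^ 2 * l ^ (-(1 + γ)) :=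
      setIntegral_mono_on (hf.mono_set (Ioi_subset_Ioi hA.le))
        ((integrableOn_Ioi_rpow_of_lt (by linarith) hA).const_mul _)
        measurableSet_Ioi fun l hl => hhigh l (hA.trans hl)
    _ = C * (1 / γ) * (N ^ 2 * (N / q) ^ (-γ)) := by
      rw [integral_const_mul, integral_Ioi_rpow_of_lt (by linarith) hA,
        show -(1 + γ) + 1 = -γ by ring, neg_div_neg_eq]
      ring
    _ = _ := by rw [sq_mul_div_rpow_neg hN hq.le]
  rw [← Ioc_union_Ioi_eq_Ioi hA.le, setIntegral_union (Ioc_disjoint_Ioi le_rfl) measurableSet_Ioi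
    (hf.mono_set Ioc_subset_Ioi_self) (hf.mono_set (Ioi_subset_Ioi hA.le))]
  linarith

variable {p : ℝ → ℝ} {ψ : ℝ → ℂ}

theorem integrable_distSq (hp : Integrable p) (hψ : Integrable ψ) (s t : ℝ) :
    Integrable fun l => p l * ‖fourierHat ψ (s * l) - fourierHat ψ (t * l)‖ ^ 2 := by
  have hcont := continuous_fourierHat hψ
  refine hp.mul_bdd (c := (2 * supNorm (fourierHat ψ)) ^ 2)
    (Continuous.aestronglyMeasurable (by fun_prop)) (ae_of_all _ fun l => ?_)
  rw [norm_pow, norm_norm]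
  exact pow_le_pow_left₀ (norm_nonneg _) (norm_fourierHat_sub_le_supNorm ψ _ _) 2

theorem distSq_nonneg (hp : ∀ l, 0 ≤ p l) (s t : ℝ) : 0 ≤ distSq p ψ s t :=
  integral_nonneg fun l => mul_nonneg (hp l) (sq_nonneg _)

theorem distSq_eq_setIntegral_Ioi (hψ : IsAnalyticWavelet ψ) {s t : ℝ} (hs : 0 ≤ s)
    (ht : 0 ≤ t) : distSq p ψ s t =
      ∫ l in Ioi 0, p l * ‖fourierHat ψ (s * l) - fourierHat ψ (t * l)‖ ^ 2 := by
  rw [distSq, setIntegral_eq_integral_of_forall_compl_eq_zero]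
  intro l hl
  have hvanish : ∀ u : ℝ, 0 ≤ u → fourierHat ψ (u * l) = 0 := fun u hu =>
    hψ.fourierHat_eq_zero _ (mul_nonpos_of_nonneg_of_nonpos hu (not_lt.1 hl))
  simp [hvanish s hs, hvanish t ht]

theorem distSq_le_integral_mul (hp0 : ∀ l, 0 ≤ p l) (hp : Integrable p) (hψ : Integrable ψ)
    (s t : ℝ) : distSq p ψ s t ≤ (∫ l, p l) * (2 * supNorm (fourierHat ψ)) ^ 2 := by
  rw [← integral_mul_const]
  refine integral_mono (integrable_distSq hp hψ s t) (hp.mul_const _) fun l => ?_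
  exact mul_le_mul_of_nonneg_left (pow_le_pow_left₀ (norm_nonneg _)
    (norm_fourierHat_sub_le_supNorm ψ _ _) 2) (hp0 l)

theorem distSq_le_rpow (hpi : Integrable p) {γ C₁ : ℝ} (hp : HighFrequencyDecay p γ C₁)
    (hψ : IsAnalyticWavelet ψ) (hlip : ∃ K : ℝ≥0, LipschitzOnWith K (fourierHat ψ) (Ici 0))
    {s t : ℝ} (hs : 0 ≤ s) (ht : 0 ≤ t) :
    distSq p ψ s t ≤ C₁ * (1 / γ + 1 / (2 - γ)) * (2 * supNorm (fourierHat ψ)) ^ (2 - γ)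
        * lipConst (fourierHat ψ) ^ γ * |s - t| ^ γ := by
  have hC := hp.const_pos
  have hdensity : ∀ l, 0 < l → p l ≤ C₁ * l ^ (-(1 + γ)) := fun l hl => by
    simpa [abs_of_pos hl] using hp.bound l hl.ne'
  have hincr : ∀ l, 0 < l → ‖fourierHat ψ (s * l) - fourierHat ψ (t * l)‖ ≤
      lipConst (fourierHat ψ) * |s - t| * l := fun l hl => by
    refine (norm_sub_le_lipConst_mul hlip (by positivity) (by positivity)).trans_eq ?_
    rw [← sub_mul, abs_mul, abs_of_pos hl, mul_assoc]
  rw [distSq_eq_setIntegral_Ioi hψ hs ht]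
  refine (setIntegral_Ioi_le_of_le_rpow (N := 2 * supNorm (fourierHat ψ))
    (q := lipConst (fourierHat ψ) * |s - t|) hp.gamma_pos hp.gamma_lt_two hC.le
    (mul_nonneg zero_le_two (supNorm_nonneg _)) (mul_nonneg (lipConst_nonneg _) (abs_nonneg _))
    (integrable_distSq hpi hψ.integrable s t).integrableOn (fun l hl => ?_)
    (fun l hl => ?_)).trans_eq ?_
  · calc p l * ‖fourierHat ψ (s * l) - fourierHat ψ (t * l)‖ ^ 2
        ≤ C₁ * l ^ (-(1 + γ)) * (lipConst (fourierHat ψ) * |s - t| * l) ^ 2 := by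
          gcongr
          exacts [hdensity l hl, hincr l hl]
      _ = C₁ * (lipConst (fourierHat ψ) * |s - t|) ^ 2 * (l ^ (-(1 + γ)) * l ^ (2 : ℝ)) := by
          rw [Real.rpow_two]
          ring
      _ = C₁ * (lipConst (fourierHat ψ) * |s - t|) ^ 2 * l ^ (1 - γ) := by
          rw [← Real.rpow_add hl]
          ring_nf
  · rw [mul_right_comm]
    gcongr
    exacts [hdensity l hl, norm_fourierHat_sub_le_supNorm ψ _ _]
  · rw [Real.mul_rpow (lipConst_nonneg _) (abs_nonneg _)]
    ring

end Increments

section Decay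

theorem integrableOn_Ioi_rpow_mul {G : ℝ → ℝ} {a M : ℝ} (hG : Integrable G)
    (hM : ∀ u, ‖G u‖ ≤ M) (ha : 0 < a) (ha1 : a ≤ 1) :
    IntegrableOn (fun u : ℝ => u ^ (a - 1) * G u) (Ioi 0) := by
  rw [← Ioc_union_Ioi_eq_Ioi zero_le_one]
  refine IntegrableOn.union ?_ ?_
  · exact (intervalIntegral.intervalIntegrable_rpow' (by linarith)).1.mul_bdd
      hG.aestronglyMeasurable.restrict (ae_of_all _ hM)
  · refine hG.integrableOn.bdd_mul (c := 1) (Measurable.aestronglyMeasurable (by fun_prop)) ?_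
    filter_upwards [ae_restrict_mem measurableSet_Ioi] with u hu
    have hu1 : 1 ≤ u := le_of_lt hu
    rw [Real.norm_of_nonneg (by positivity)]
    exact Real.rpow_le_one_of_one_le_of_nonpos hu1 (by linarith)

theorem rpow_mul_comp_mul_left_eq {s l : ℝ} (hs : 0 < s) (hl : 0 < l) (b : ℝ) (G : ℝ → ℝ) :
    l ^ b * G (s * l) = s ^ (-b) * ((s * l) ^ b * G (s * l)) := by
  rw [Real.mul_rpow hs.le hl.le, Real.rpow_neg hs.le]
  field_simp

theorem setIntegral_Ioi_rpow_mul_comp_mul_left {s : ℝ} (hs : 0 < s) (b : ℝ) (G : ℝ → ℝ) :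
    ∫ l in Ioi 0, l ^ b * G (s * l) = s ^ (-(b + 1)) * ∫ u in Ioi 0, u ^ b * G u := by
  have hscale := integral_comp_mul_left_Ioi (fun u : ℝ => u ^ b * G u) 0 hs
  rw [setIntegral_congr_fun measurableSet_Ioi fun l hl => rpow_mul_comp_mul_left_eq hs hl b G,
    integral_const_mul, hscale, mul_zero, smul_eq_mul, ← mul_assoc, neg_add, Real.rpow_add hs,
    Real.rpow_neg_one]

theorem integrableOn_Ioi_rpow_mul_comp_mul_left {s b : ℝ} (hs : 0 < s) {G : ℝ → ℝ}
    (hG : IntegrableOn (fun u : ℝ => u ^ b * G u) (Ioi 0)) :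
    IntegrableOn (fun l : ℝ => l ^ b * G (s * l)) (Ioi 0) := by
  have hscale := (integrableOn_Ioi_comp_mul_left_iff (fun u : ℝ => u ^ b * G u) 0 hs).2
    (by simpa using hG)
  exact IntegrableOn.congr_fun (hscale.const_mul (s ^ (-b)))
    (fun l hl => (rpow_mul_comp_mul_left_eq hs hl b G).symm) measurableSet_Ioi

variable {p : ℝ → ℝ} {ψ : ℝ → ℂ}

theorem exists_distSq_zero_le_of_density_le (hpi : Integrable p) (hψ : IsAnalyticWavelet ψ)
    {a A B : ℝ} (ha : 0 < a) (ha1 : a ≤ 1) (hB : 0 ≤ B)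
    (hp : ∀ l, 0 < l → p l ≤ A * l ^ (a - 1) + B) :
    ∃ C, ∀ s, 1 ≤ s → distSq p ψ s 0 ≤ C * s ^ (-a) := by
  set G : ℝ → ℝ := fun w => ‖fourierHat ψ w‖ ^ 2
  have hG : Integrable G := integrable_sq_norm_fourierHat hψ.integrable hψ.memLp_two
  have hGbdd : ∀ w, ‖G w‖ ≤ supNorm (fourierHat ψ) ^ 2 := fun w => by
    rw [Real.norm_of_nonneg (sq_nonneg _)]
    exact pow_le_pow_left₀ (norm_nonneg _) (norm_fourierHat_le_supNorm ψ w) 2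
  have hGa := integrableOn_Ioi_rpow_mul hG hGbdd ha ha1
  have hG1 := integrableOn_Ioi_rpow_mul hG hGbdd one_pos le_rfl
  set I := ∫ u in Ioi (0 : ℝ), u ^ (a - 1) * G u
  set J := ∫ u in Ioi (0 : ℝ), u ^ ((1 : ℝ) - 1) * G u
  have hJ : 0 ≤ J := setIntegral_nonneg measurableSet_Ioi fun u hu =>
    mul_nonneg (Real.rpow_nonneg (le_of_lt hu) _) (sq_nonneg _)
  refine ⟨A * I + B * J, fun s hs => ?_⟩
  have hs0 : 0 < s := zero_lt_one.trans_le hs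
  have hinta := (integrableOn_Ioi_rpow_mul_comp_mul_left hs0 hGa).const_mul A
  have hint1 := (integrableOn_Ioi_rpow_mul_comp_mul_left hs0 hG1).const_mul B
  have hint := integrable_distSq hpi hψ.integrable s 0
  rw [distSq_eq_setIntegral_Ioi hψ hs0.le le_rfl]
  simp only [zero_mul, hψ.fourierHat_eq_zero 0 le_rfl, sub_zero] at hint ⊢
  calc ∫ l in Ioi 0, p l * G (s * l)
      ≤ ∫ l in Ioi 0, (A * (l ^ (a - 1) * G (s * l)) + B * (l ^ ((1 : ℝ) - 1) * G (s * l))) := by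
        refine setIntegral_mono_on hint.integrableOn (hinta.add hint1) measurableSet_Ioi
          fun l hl => ?_
        rw [sub_self, Real.rpow_zero, one_mul, ← mul_assoc, ← add_mul]
        exact mul_le_mul_of_nonneg_right (hp l hl) (sq_nonneg _)
    _ = A * (s ^ (-a) * I) + B * (s ^ (-1 : ℝ) * J) := by
        rw [integral_add hinta hint1, integral_const_mul, integral_const_mul,
          setIntegral_Ioi_rpow_mul_comp_mul_left hs0, setIntegral_Ioi_rpow_mul_comp_mul_left hs0,
          sub_add_cancel, sub_add_cancel]
    _ ≤ A * (s ^ (-a) * I) + B * (s ^ (-a) * J) := by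
        gcongr
    _ = (A * I + B * J) * s ^ (-a) := by ring

/-- The growth condition on the density `p` at low frequencies, common to long-range and short-range
dependence, under which `E |W_Φ(0,s)|²` is eventually at most `s ^ (-h)`. Adding the constant `B`
lets one inequality cover all positive frequencies. -/
def LowFrequencyBound (p : ℝ → ℝ) (h : ℝ) : Prop :=
  ∃ a A B : ℝ, h < a ∧ a ≤ 1 ∧ 0 ≤ B ∧ ∀ l, 0 < l → p l ≤ A * l ^ (a - 1) + B

theorem LowFrequencyBound.exists_distSq_zero_le_rpow_neg {h : ℝ} (hp : LowFrequencyBound p h)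
    (hpi : Integrable p) (hψ : IsAnalyticWavelet ψ) (hh : 0 < h) :
    ∃ T, 0 < T ∧ ∀ s, T ≤ s → distSq p ψ s 0 ≤ s ^ (-h) := by
  obtain ⟨a, A, B, ha, ha1, hB, hp⟩ := hp
  obtain ⟨C, hC⟩ := exists_distSq_zero_le_of_density_le hpi hψ (hh.trans ha) ha1 hB hp
  obtain ⟨T, hT⟩ := eventually_atTop.1
    ((tendsto_rpow_atTop (sub_pos.2 ha)).eventually_ge_atTop C)
  refine ⟨max T 1, by positivity, fun s hs => ?_⟩
  have hs1 : 1 ≤ s := (le_max_right _ _).trans hs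
  calc distSq p ψ s 0 ≤ C * s ^ (-a) := hC s hs1
    _ ≤ s ^ (a - h) * s ^ (-a) := by
      gcongr
      exact hT s ((le_max_left _ _).trans hs)
    _ = s ^ (-h) := by
      rw [← Real.rpow_add (zero_lt_one.trans_le hs1)]
      ring_nf

theorem le_mul_rpow_of_doubling {L : ℝ → ℝ} {r₀ M η : ℝ} (hr₀ : 1 ≤ r₀) (hM : 0 ≤ M)
    (hη : 0 ≤ η) (hbase : ∀ r ∈ Icc r₀ (2 * r₀), L r ≤ M)
    (hdouble : ∀ r, r₀ ≤ r → L (2 * r) ≤ 2 ^ η * L r) {r : ℝ} (hr : r₀ ≤ r) :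
    L r ≤ M * r ^ η := by
  obtain ⟨n, hn⟩ : ∃ n : ℕ, r ≤ 2 ^ n * (2 * r₀) := by
    obtain ⟨n, hn⟩ := pow_unbounded_of_one_lt r one_lt_two
    exact ⟨n, hn.le.trans (le_mul_of_one_le_right (by positivity) (by linarith))⟩
  induction n generalizing r with
  | zero =>
    exact (hbase r ⟨hr, by simpa using hn⟩).trans
      (le_mul_of_one_le_right hM (Real.one_le_rpow (hr₀.trans hr) hη))
  | succ n ih =>
    rcases le_total r (2 * r₀) with hr2 | hr2
    · exact (hbase r ⟨hr, hr2⟩).trans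
        (le_mul_of_one_le_right hM (Real.one_le_rpow (hr₀.trans hr) hη))
    calc L r = L (2 * (r / 2)) := by rw [mul_div_cancel₀ r two_ne_zero]
      _ ≤ 2 ^ η * L (r / 2) := hdouble _ (by linarith)
      _ ≤ 2 ^ η * (M * (r / 2) ^ η) := by
        gcongr
        exact ih (by linarith) (by rw [pow_succ] at hn; linarith)
      _ = M * r ^ η := by
        rw [Real.div_rpow (by linarith) zero_le_two]
        field_simp

theorem IsSlowlyVarying.exists_le_mul_rpow {L : ℝ → ℝ} (hL : IsSlowlyVarying L) {η : ℝ}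
    (hη : 0 < η) : ∃ C r₀ : ℝ, 0 < C ∧ 0 < r₀ ∧ ∀ r, r₀ ≤ r → L r ≤ C * r ^ η := by
  obtain ⟨r₁, hr₁⟩ := eventually_atTop.1 ((hL.ratio_tendsto 2 two_pos).eventually
    (gt_mem_nhds (Real.one_lt_rpow one_lt_two hη)))
  have hr₀ : 0 < max r₁ 1 := by positivity
  obtain ⟨M, hM⟩ := hL.locally_bounded (max r₁ 1) (2 * max r₁ 1) hr₀
  have hMpos : 0 < M := (hL.pos _ hr₀).trans_le (hM _ ⟨le_rfl, by linarith⟩)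
  refine ⟨M, max r₁ 1, hMpos, hr₀, fun r hr => ?_⟩
  refine le_mul_rpow_of_doubling (le_max_right _ _) hMpos.le hη.le hM (fun u hu => ?_) hr
  exact ((div_lt_iff₀ (hL.pos u (hr₀.trans_le hu))).1 (hr₁ u ((le_max_left _ _).trans hu))).le

theorem LongRangeDependent.lowFrequencyBound {γ C₁ H h : ℝ} (hp : HighFrequencyDecay p γ C₁)
    (hdep : LongRangeDependent p H) (hh : h < H) : LowFrequencyBound p h := by
  obtain ⟨-, hH1, L, hL, hpL⟩ := hdep
  obtain ⟨C, r₀, hC, hr₀, hLr⟩ := hL.exists_le_mul_rpow (η := (H - h) / 2) (by linarith)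
  have hC₁ := hp.const_pos
  refine ⟨(H + h) / 2, C, C₁ * r₀⁻¹ ^ (-(1 + γ)), by linarith, by linarith, by positivity,
    fun l hl => ?_⟩
  rcases le_total l r₀⁻¹ with hl₀ | hl₀
  · refine le_add_of_le_of_nonneg ?_ (by positivity)
    rw [hpL l hl.ne', abs_of_pos hl]
    calc L l⁻¹ * l ^ (H - 1) ≤ C * l⁻¹ ^ ((H - h) / 2) * l ^ (H - 1) := by
          gcongr
          exact hLr _ ((le_inv_comm₀ hl hr₀).1 hl₀)
      _ = C * l ^ ((H + h) / 2 - 1) := by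
          rw [Real.inv_rpow hl.le, ← Real.rpow_neg hl.le, mul_assoc, ← Real.rpow_add hl]
          ring_nf
  · refine le_add_of_nonneg_of_le (by positivity) ((hp.bound l hl.ne').trans ?_)
    rw [abs_of_pos hl]
    exact mul_le_mul_of_nonneg_left (Real.rpow_le_rpow_of_nonpos (by positivity) hl₀
      (by linarith [hp.gamma_pos])) hC₁.le

theorem ShortRangeDependent.lowFrequencyBound {h : ℝ} (hdep : ShortRangeDependent p)
    (hh : h < 1) : LowFrequencyBound p h := by
  obtain ⟨⟨M, hM⟩, -⟩ := hdep
  refine ⟨1, 0, max M 0, hh, le_rfl, le_max_right _ _, fun l _ => ?_⟩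
  rw [zero_mul, zero_add]
  exact (hM l).trans (le_max_left _ _)

end Decay

section Chaining

variable {Ω : Type*} [MeasurableSpace Ω] {P : Measure Ω} [IsProbabilityMeasure P]
  {E : Type*} [NormedAddCommGroup E] {ι : Type*}

-- The tangent inequality `y + 1 ≤ exp y` at `y = τ x - a`, divided by `τ`.
theorem le_div_add_exp_mul_exp {τ : ℝ} (hτ : 0 < τ) (a x : ℝ) :
    x ≤ (a - 1) / τ + Real.exp (-a) / τ * Real.exp (τ * x) := by
  rw [div_mul_eq_mul_div, ← Real.exp_add, neg_add_eq_sub, ← add_div, le_div_iff₀ hτ]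
  linarith [Real.add_one_le_exp (τ * x - a)]

theorem one_le_log_four_mul {n : ℝ} (hn : 1 ≤ n) : 1 ≤ Real.log (4 * n) := by
  rw [Real.le_log_iff_exp_le (by positivity)]
  linarith [Real.exp_one_lt_d9]

theorem lintegral_iSup_le_add_sum {I : Finset ι} {f g : ι → Ω → ℝ≥0∞} {b : ℝ≥0∞}
    (hg : ∀ i ∈ I, AEMeasurable (g i) P) (hfg : ∀ i ∈ I, ∀ ω, f i ω ≤ b + g i ω) :
    ∫⁻ ω, ⨆ i ∈ I, f i ω ∂P ≤ b + ∑ i ∈ I, ∫⁻ ω, g i ω ∂P := calc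
  ∫⁻ ω, ⨆ i ∈ I, f i ω ∂P ≤ ∫⁻ ω, (b + ∑ i ∈ I, g i ω) ∂P :=
    lintegral_mono fun ω => iSup₂_le fun i hi => (hfg i hi ω).trans (by
      gcongr
      exact Finset.single_le_sum (f := fun i => g i ω) (fun _ _ => zero_le) hi)
  _ = b + ∑ i ∈ I, ∫⁻ ω, g i ω ∂P := by
    rw [lintegral_add_left measurable_const, lintegral_const, measure_univ, mul_one,
      lintegral_finsetSum' _ hg]

theorem lintegral_iSup_enorm_le_of_pos {I : Finset ι} {Z : ι → Ω → E} {r n τ : ℝ}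
    (hZ : ∀ i ∈ I, HasSubgaussianNorm (Z i) (r ^ 2) P) (hn1 : 1 ≤ n) (hn : (I.card : ℝ) ≤ n)
    (hτ : 0 < τ) :
    ∫⁻ ω, ⨆ i ∈ I, ‖Z i ω‖ₑ ∂P ≤ ENNReal.ofReal (Real.log (4 * n) / τ + τ * r ^ 2) := by
  set a := Real.log (4 * n) + τ ^ 2 * r ^ 2 with ha
  set c := Real.exp (-a) / τ with hc
  set b := (a - 1) / τ with hb
  have hc0 : 0 ≤ c := by positivity
  have hb0 : 0 ≤ b := div_nonneg
    (by linarith [one_le_log_four_mul hn1, show 0 ≤ τ ^ 2 * r ^ 2 by positivity]) hτ.le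
  have hpointwise : ∀ z : E, ‖z‖ₑ ≤
      ENNReal.ofReal b + ENNReal.ofReal c * ENNReal.ofReal (Real.exp (τ * ‖z‖)) := fun z => by
    rw [← ENNReal.ofReal_mul hc0, ← ENNReal.ofReal_add hb0 (by positivity), ← ofReal_norm]
    exact ENNReal.ofReal_le_ofReal (le_div_add_exp_mul_exp hτ a ‖z‖)
  have hmeas : ∀ i ∈ I, AEMeasurable (fun ω =>
      ENNReal.ofReal c * ENNReal.ofReal (Real.exp (τ * ‖Z i ω‖))) P := fun i hi =>
    (Real.measurable_exp.comp_aemeasurable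
      ((hZ i hi).aestronglyMeasurable.norm.aemeasurable.const_mul τ)).ennreal_ofReal.const_mul _
  have hmoment : c * (4 * Real.exp (τ ^ 2 * r ^ 2)) = 1 / (n * τ) := by
    rw [hc, ha, neg_add, Real.exp_add, Real.exp_neg, Real.exp_neg, Real.exp_log (by positivity)]
    field_simp
  calc ∫⁻ ω, ⨆ i ∈ I, ‖Z i ω‖ₑ ∂P
      ≤ ENNReal.ofReal b + ∑ i ∈ I, ∫⁻ ω,
          ENNReal.ofReal c * ENNReal.ofReal (Real.exp (τ * ‖Z i ω‖)) ∂P :=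
        lintegral_iSup_le_add_sum hmeas fun _ _ _ => hpointwise _
    _ = ENNReal.ofReal b + ∑ i ∈ I, ENNReal.ofReal c *
        ∫⁻ ω, ENNReal.ofReal (Real.exp (τ * ‖Z i ω‖)) ∂P := by
        simp only [lintegral_const_mul' _ _ ENNReal.ofReal_ne_top]
    _ ≤ ENNReal.ofReal b + ∑ _i ∈ I, ENNReal.ofReal c *
        ENNReal.ofReal (4 * Real.exp (τ ^ 2 * r ^ 2)) := by
        gcongr with i hi
        exact (hZ i hi).lintegral_exp_le τ hτ.le
    _ = ENNReal.ofReal (b + I.card * (1 / (n * τ))) := by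
        rw [Finset.sum_const, nsmul_eq_mul, ← ENNReal.ofReal_mul hc0, hmoment,
          ENNReal.ofReal_add hb0 (by positivity), ENNReal.ofReal_mul (Nat.cast_nonneg _),
          ENNReal.ofReal_natCast]
    _ ≤ ENNReal.ofReal (b + n * (1 / (n * τ))) := by gcongr
    _ = _ := by
        rw [hb, ha]
        field_simp
        ring_nf

theorem lintegral_iSup_enorm_le {I : Finset ι} {Z : ι → Ω → E} {r n : ℝ} (hr : 0 < r)
    (hZ : ∀ i ∈ I, HasSubgaussianNorm (Z i) (r ^ 2) P) (hn1 : 1 ≤ n) (hn : (I.card : ℝ) ≤ n) :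
    ∫⁻ ω, ⨆ i ∈ I, ‖Z i ω‖ₑ ∂P ≤ ENNReal.ofReal (2 * r * √(Real.log (4 * n))) := by
  have hlog : 0 < Real.log (4 * n) := zero_lt_one.trans_le (one_le_log_four_mul hn1)
  have hsqrt := Real.sqrt_pos.2 hlog
  refine (lintegral_iSup_enorm_le_of_pos hZ hn1 hn (div_pos hsqrt hr)).trans_eq ?_
  congr 1
  nth_rw 1 [← Real.mul_self_sqrt hlog.le]
  field_simp
  ring

/-- Finite nets `N k` of an index set, starting from the single point `s₀`, such that every index
is within distance `ε k` of a point `π k s` of `N k`. The squared distance is `D`. -/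
structure IsChainingSequence (D : ι → ι → ℝ) (s₀ : ι) (ε : ℕ → ℝ) (N : ℕ → Finset ι)
    (π : ℕ → ι → ι) : Prop where
  zero_eq : N 0 = {s₀}
  mem : ∀ k s, π k s ∈ N k
  le_sq : ∀ k s, D s (π k s) ≤ ε k ^ 2

variable {D : ι → ι → ℝ} {s₀ : ι} {ε : ℕ → ℝ} {N : ℕ → Finset ι} {π : ℕ → ι → ι}

theorem IsChainingSequence.enorm_le_sum (hN : IsChainingSequence D s₀ ε N π) {x : ι → E}
    (hx : x s₀ = 0) {k : ℕ} {t : ι} (ht : t ∈ N k) :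
    ‖x t‖ₑ ≤ ∑ j ∈ Finset.range k, ⨆ u ∈ N (j + 1), ‖x u - x (π j u)‖ₑ := by
  induction k generalizing t with
  | zero =>
    rw [hN.zero_eq, Finset.mem_singleton] at ht
    simp [ht, hx]
  | succ k ih =>
    rw [Finset.sum_range_succ, add_comm]
    calc ‖x t‖ₑ = ‖(x t - x (π k t)) + x (π k t)‖ₑ := by rw [sub_add_cancel]
      _ ≤ ‖x t - x (π k t)‖ₑ + ‖x (π k t)‖ₑ := enorm_add_le _ _
      _ ≤ _ := add_le_add (le_iSup₂ (f := fun u _ => ‖x u - x (π k u)‖ₑ) t ht) (ih (hN.mem k t))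

variable {X : ι → Ω → E} {n b : ℕ → ℝ} {B : ℝ}

theorem IsChainingSequence.lintegral_iSup_sub_le (hN : IsChainingSequence D s₀ ε N π)
    (hX : ∀ s t, HasSubgaussianNorm (X s - X t) (D s t) P) {k : ℕ} (hε : 0 < ε k)
    {I : Finset ι} {m : ℝ} (hm1 : 1 ≤ m) (hm : (I.card : ℝ) ≤ m) :
    ∫⁻ ω, ⨆ s ∈ I, ‖X s ω - X (π k s) ω‖ₑ ∂P ≤
      ENNReal.ofReal (2 * ε k * √(Real.log (4 * m))) :=
  lintegral_iSup_enorm_le (Z := fun s => X s - X (π k s)) hε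
    (fun s _ => (hX s (π k s)).mono (hN.le_sq k s)) hm1 hm

theorem IsChainingSequence.lintegral_iSup_enorm_le (hN : IsChainingSequence D s₀ ε N π)
    (hX : ∀ s t, HasSubgaussianNorm (X s - X t) (D s t) P) (hX0 : X s₀ = 0)
    (hε : ∀ k, 0 < ε k) (hε0 : Tendsto ε atTop (𝓝 0)) (hn : ∀ k, ((N (k + 1)).card : ℝ) ≤ n k)
    (hb : ∀ k, 2 * ε k * √(Real.log (4 * n k)) ≤ b k) (hB : HasSum b B) (F : Finset ι) :
    ∫⁻ ω, ⨆ s ∈ F, ‖X s ω‖ₑ ∂P ≤ ENNReal.ofReal B := by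
  set M : ℕ → Ω → ℝ≥0∞ := fun k ω => ⨆ t ∈ N (k + 1), ‖X t ω - X (π k t) ω‖ₑ
  have hmeas : ∀ (I : Finset ι) k, AEMeasurable (fun ω => ⨆ t ∈ I, ‖X t ω - X (π k t) ω‖ₑ) P :=
    fun I k => AEMeasurable.biSup _ I.countable_toSet
      fun t _ => (hX t (π k t)).aestronglyMeasurable.enorm
  have hn1 : ∀ k, 1 ≤ n k := fun k =>
    le_trans (by exact_mod_cast Finset.card_pos.2 ⟨_, hN.mem (k + 1) s₀⟩) (hn k)
  have hb0 : ∀ k, 0 ≤ b k := fun k =>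
    (mul_nonneg (mul_nonneg zero_le_two (hε k).le) (Real.sqrt_nonneg _)).trans (hb k)
  have hbound : ∀ k, ∫⁻ ω, ⨆ s ∈ F, ‖X s ω‖ₑ ∂P ≤
      ENNReal.ofReal (2 * ε k * √(Real.log (4 * (F.card + 1)))) + ENNReal.ofReal B := fun k => calc
    _ ≤ ∫⁻ ω, ((⨆ s ∈ F, ‖X s ω - X (π k s) ω‖ₑ) + ∑ j ∈ Finset.range k, M j ω) ∂P := by
      refine lintegral_mono fun ω => iSup₂_le fun s hs => ?_
      calc ‖X s ω‖ₑ = ‖(X s ω - X (π k s) ω) + X (π k s) ω‖ₑ := by rw [sub_add_cancel]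
        _ ≤ ‖X s ω - X (π k s) ω‖ₑ + ‖X (π k s) ω‖ₑ := enorm_add_le _ _
        _ ≤ _ := add_le_add (le_iSup₂ (f := fun s _ => ‖X s ω - X (π k s) ω‖ₑ) s hs)
          (hN.enorm_le_sum (x := fun t => X t ω) (congrFun hX0 ω) (hN.mem k s))
    _ = ∫⁻ ω, ⨆ s ∈ F, ‖X s ω - X (π k s) ω‖ₑ ∂P + ∑ j ∈ Finset.range k, ∫⁻ ω, M j ω ∂P := by
      rw [lintegral_add_left' (hmeas F k), lintegral_finsetSum' _ fun j _ => hmeas _ j]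
    _ ≤ ENNReal.ofReal (2 * ε k * √(Real.log (4 * (F.card + 1)))) +
        ∑ j ∈ Finset.range k, ENNReal.ofReal (b j) := by
      gcongr with j
      · exact hN.lintegral_iSup_sub_le hX (hε k) (by simp) (by simp)
      · exact (hN.lintegral_iSup_sub_le hX (hε j) (hn1 j) (hn j)).trans
          (ENNReal.ofReal_le_ofReal (hb j))
    _ ≤ _ := by
      rw [← ENNReal.ofReal_sum_of_nonneg fun j _ => hb0 j]
      gcongr
      exact sum_le_hasSum _ (fun j _ => hb0 j) hB
  have hlim : Tendsto (fun k => ENNReal.ofReal (2 * ε k * √(Real.log (4 * (F.card + 1)))) +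
      ENNReal.ofReal B) atTop (𝓝 (ENNReal.ofReal (2 * 0 * √(Real.log (4 * (F.card + 1)))) +
      ENNReal.ofReal B)) :=
    (ENNReal.tendsto_ofReal ((hε0.const_mul 2).mul_const _)).add_const _
  simpa using ge_of_tendsto' hlim hbound

end Chaining

section Grid

/-- The largest multiple of the mesh `r` below `s`. -/
noncomputable def gridFloor (r s : ℝ≥0) : ℝ≥0 := r * ⌊s / r⌋₊

theorem gridFloor_le (r s : ℝ≥0) : gridFloor r s ≤ s := calc
  r * ⌊s / r⌋₊ ≤ r * (s / r) := by gcongr; exact Nat.floor_le zero_le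
  _ = s * (r / r) := mul_div_left_comm ..
  _ ≤ s := mul_le_of_le_one_right' (div_self_le_one r)

theorem lt_gridFloor_add {r : ℝ≥0} (hr : 0 < r) (s : ℝ≥0) : s < gridFloor r s + r := by
  have hlt := (div_lt_iff₀ hr).1 (Nat.lt_floor_add_one (s / r))
  rw [gridFloor]
  linarith

theorem dist_gridFloor_le {r : ℝ≥0} (hr : 0 < r) (s : ℝ≥0) : dist s (gridFloor r s) ≤ r := by
  have hle : (gridFloor r s : ℝ) ≤ s := gridFloor_le r s
  have hadd : (s : ℝ) < gridFloor r s + r := lt_gridFloor_add hr s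
  rw [NNReal.dist_eq, abs_of_nonneg (sub_nonneg.2 hle)]
  linarith

theorem exists_grid (S : ℝ≥0) {r : ℝ≥0} (hr : 0 < r) :
    ∃ (N : Finset ℝ≥0) (π : ℝ≥0 → ℝ≥0), (∀ s, π s ∈ N) ∧
      (∀ s, S ≤ s ∧ π s = 0 ∨ dist s (π s) ≤ r) ∧ (N.card : ℝ) ≤ S / r + 1 := by
  classical
  refine ⟨(Finset.range (⌊S / r⌋₊ + 1)).image fun j : ℕ => r * j,
    fun s => if S ≤ s then 0 else gridFloor r s, fun s => ?_, fun s => ?_, ?_⟩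
  · rw [Finset.mem_image]
    dsimp only
    split_ifs with hs
    · exact ⟨0, by simp, by simp⟩
    · refine ⟨⌊s / r⌋₊, Finset.mem_range.2 (Nat.lt_succ_of_le (Nat.floor_le_floor ?_)), rfl⟩
      exact div_le_div_of_nonneg_right (not_le.1 hs).le zero_le
  · dsimp only
    split_ifs with hs
    · exact Or.inl ⟨hs, rfl⟩
    · exact Or.inr (dist_gridFloor_le hr s)
  · have hcard : ((Finset.range (⌊S / r⌋₊ + 1)).image fun j : ℕ => r * (j : ℝ≥0)).card ≤
        ⌊S / r⌋₊ + 1 := Finset.card_image_le.trans (Finset.card_range _).le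
    calc _ ≤ ((⌊S / r⌋₊ + 1 : ℕ) : ℝ) := Nat.cast_le.2 hcard
      _ ≤ S / r + 1 := by
        push_cast
        gcongr
        exact_mod_cast Nat.floor_le (a := S / r) zero_le

end Grid

section Dudley

variable {D : ℝ≥0 → ℝ≥0 → ℝ} {γ h C T Δ : ℝ}

/-- Bound for the cardinality of a net of `[0, ∞)` of scale `x⁻¹`, when distances are at most
`C |s - t| ^ (γ / 2)`, and the distance from `s ≥ T` to `0` is at most `s ^ (-h / 2)`. -/
noncomputable def netCard (γ h C T x : ℝ) : ℝ := 2 * (max 1 T * x ^ (2 / h) * (C * x) ^ (2 / γ))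

-- The point `0` serves all `s ≥ max 1 T * x ^ (2 / h)`, and a grid of mesh `(C * x) ^ (-2 / γ)`
-- serves the others.
theorem exists_net (hγ : 0 < γ) (hh : 0 < h) (hC : 1 ≤ C)
    (hHol : ∀ s t, D s t ≤ C ^ 2 * dist s t ^ γ) (hTail : ∀ s : ℝ≥0, T ≤ s → D s 0 ≤ s ^ (-h))
    {x : ℝ} (hx : 1 ≤ x) :
    ∃ (N : Finset ℝ≥0) (π : ℝ≥0 → ℝ≥0), (∀ s, π s ∈ N) ∧ (∀ s, D s (π s) ≤ x⁻¹ ^ 2) ∧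
      (N.card : ℝ) ≤ netCard γ h C T x := by
  have hx0 : 0 < x := by linarith
  have : 0 < C := by linarith
  have hxh : 1 ≤ x ^ (2 / h) := Real.one_le_rpow hx (by positivity)
  have hmesh : 1 ≤ (C * x) ^ (2 / γ) :=
    Real.one_le_rpow (one_le_mul_of_one_le_of_one_le hC hx) (by positivity)
  have hmesh0 : 0 < (C * x) ^ (2 / γ) := by linarith
  have hM : 1 ≤ max 1 T := le_max_left _ _
  set S : ℝ≥0 := ⟨max 1 T * x ^ (2 / h), by positivity⟩
  set r : ℝ≥0 := ⟨((C * x) ^ (2 / γ))⁻¹, by positivity⟩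
  obtain ⟨N, π, hN, hπ, hcard⟩ := exists_grid S (r := r) (inv_pos.2 hmesh0)
  refine ⟨N, π, hN, fun s => ?_, hcard.trans ?_⟩
  · rcases hπ s with ⟨hs, hs0⟩ | hs
    · have hxs : x ^ (2 / h) ≤ s := (le_mul_of_one_le_left (by positivity) hM).trans hs
      have hTs : T ≤ s := ((le_max_right 1 T).trans
        (le_mul_of_one_le_right (by positivity) hxh)).trans hs
      rw [hs0]
      calc D s 0 ≤ (s : ℝ) ^ (-h) := hTail s hTs
        _ ≤ (x ^ (2 / h)) ^ (-h) := Real.rpow_le_rpow_of_nonpos (by positivity) hxs (by linarith)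
        _ = x⁻¹ ^ 2 := by
          rw [← Real.rpow_mul hx0.le, show 2 / h * -h = -(2 : ℕ) by push_cast; field_simp,
            Real.rpow_neg hx0.le, Real.rpow_natCast, inv_pow]
    · calc D s (π s) ≤ C ^ 2 * dist s (π s) ^ γ := hHol _ _
        _ ≤ C ^ 2 * ((C * x) ^ (2 / γ))⁻¹ ^ γ := by gcongr; exact hs
        _ = x⁻¹ ^ 2 := by
          rw [Real.inv_rpow hmesh0.le, ← Real.rpow_mul (by positivity),
            show 2 / γ * γ = (2 : ℕ) by push_cast; field_simp, Real.rpow_natCast]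
          field_simp
  · have hSr : (S / r : ℝ) = max 1 T * x ^ (2 / h) * (C * x) ^ (2 / γ) := div_inv_eq_mul _ _
    have hone : 1 ≤ max 1 T * x ^ (2 / h) * (C * x) ^ (2 / γ) :=
      one_le_mul_of_one_le_of_one_le (one_le_mul_of_one_le_of_one_le hM hxh) hmesh
    rw [hSr, netCard]
    linarith

theorem log_four_mul_netCard (γ h T : ℝ) (hC : 0 < C) {x : ℝ} (hx : 0 < x) :
    Real.log (4 * netCard γ h C T x) = 3 * Real.log 2 + Real.log (max 1 T) +
      2 * (1 / γ * Real.log C) + 2 * (1 / γ + 1 / h) * Real.log x := by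
  have : 0 < max 1 T := zero_lt_one.trans_le (le_max_left _ _)
  rw [netCard, ← mul_assoc, show (4 * 2 : ℝ) = 2 ^ 3 by norm_num,
    Real.log_mul (by positivity) (by positivity), Real.log_mul (by positivity) (by positivity),
    Real.log_mul (by positivity) (by positivity), Real.log_rpow hx, Real.log_rpow (by positivity),
    Real.log_mul hC.ne' hx.ne', Real.log_pow]
  push_cast
  ring

-- `√(3 log 2 + c ^ 2 + 2 * b ^ 2 + 2 * k * a ^ 2) ≤ 2 * ((k + 1) * a + (b + c))`, where
-- `3 log 2 ≤ 4 * a ^ 2` because `γ < 2`, `h ≤ 1` and `2 ≤ Δ`.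
theorem sqrt_log_four_mul_netCard_le (T : ℝ) (hγ : 0 < γ) (hγ2 : γ < 2) (hh : 0 < h) (hh1 : h ≤ 1)
    (hC : 1 ≤ C) (hΔ : 2 ≤ Δ) (k : ℕ) :
    √(Real.log (4 * netCard γ h C T (Δ ^ k))) ≤
      2 * ((k + 1) * (√(Real.log Δ) * √(1 / γ + 1 / h)) +
        (√(1 / γ * Real.log C) + √(Real.log (max 1 T)))) := by
  have hlogΔ : Real.log 2 ≤ Real.log Δ := Real.log_le_log two_pos hΔ
  have hlog2 : 0 < Real.log 2 := Real.log_pos one_lt_two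
  have hγ' : 1 / 2 ≤ 1 / γ := one_div_le_one_div_of_le hγ hγ2.le
  have hh' : 1 ≤ 1 / h := (one_le_div hh).2 hh1
  have ha : (√(Real.log Δ) * √(1 / γ + 1 / h)) ^ 2 = Real.log Δ * (1 / γ + 1 / h) := by
    rw [mul_pow, Real.sq_sqrt (by linarith), Real.sq_sqrt (by linarith)]
  have hb : √(1 / γ * Real.log C) ^ 2 = 1 / γ * Real.log C :=
    Real.sq_sqrt (mul_nonneg (by linarith) (Real.log_nonneg hC))
  have hc : √(Real.log (max 1 T)) ^ 2 = Real.log (max 1 T) :=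
    Real.sq_sqrt (Real.log_nonneg (le_max_left _ _))
  have ha2 : 3 / 2 * Real.log 2 ≤ (√(Real.log Δ) * √(1 / γ + 1 / h)) ^ 2 := by
    rw [ha]
    nlinarith
  have hlog : Real.log (4 * netCard γ h C T (Δ ^ k)) = 3 * Real.log 2 + Real.log (max 1 T) +
      2 * (1 / γ * Real.log C) + 2 * k * (Real.log Δ * (1 / γ + 1 / h)) := by
    rw [log_four_mul_netCard γ h T (by linarith) (by positivity), Real.log_pow]
    ring
  rw [Real.sqrt_le_left (by positivity), hlog]
  set a := √(Real.log Δ) * √(1 / γ + 1 / h)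
  set b := √(1 / γ * Real.log C)
  set c := √(Real.log (max 1 T))
  rw [← ha, ← hb, ← hc]
  have hcross : 0 ≤ (k + 1) * a * (b + c) + b * c := by positivity
  have hka : 0 ≤ (4 * (k : ℝ) ^ 2 + 6 * k) * a ^ 2 := by positivity
  nlinarith [sq_nonneg b, sq_nonneg c]

theorem hasSum_dudleyBound (hΔ : 1 < Δ) (γ h C T : ℝ) :
    HasSum (fun k : ℕ => Δ * Δ⁻¹ ^ k *
      (4 * ((k + 1) * (√(Real.log Δ) * √(1 / γ + 1 / h)) +
        (√(1 / γ * Real.log C) + √(Real.log (max 1 T))))))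
      (dudleyBound Δ γ h C T) := by
  have : 0 < Δ := by linarith
  have hΔ1 : Δ - 1 ≠ 0 := by linarith
  have hinv0 : 0 ≤ Δ⁻¹ := by positivity
  have hinv1 : Δ⁻¹ < 1 := inv_lt_one_of_one_lt₀ hΔ
  have hsub : 1 - Δ⁻¹ = (Δ - 1) / Δ := by field_simp
  obtain ⟨a, ha⟩ : ∃ a, a = √(Real.log Δ) * √(1 / γ + 1 / h) := ⟨_, rfl⟩
  obtain ⟨b, hb⟩ : ∃ b, b = √(1 / γ * Real.log C) + √(Real.log (max 1 T)) := ⟨_, rfl⟩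
  have hval : dudleyBound Δ γ h C T =
      4 * Δ * a * (Δ⁻¹ / (1 - Δ⁻¹) ^ 2) + 4 * Δ * (a + b) * (1 - Δ⁻¹)⁻¹ := by
    rw [hsub, dudleyBound, ← hb, mul_right_comm √(Real.log Δ), ← ha]
    field_simp
    ring
  rw [hval, ← ha, ← hb]
  have hlinear : HasSum (fun k : ℕ => (k : ℝ) * Δ⁻¹ ^ k) (Δ⁻¹ / (1 - Δ⁻¹) ^ 2) :=
    hasSum_coe_mul_geometric_of_norm_lt_one (by rwa [Real.norm_of_nonneg hinv0])
  refine ((hlinear.mul_left (4 * Δ * a)).add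
    ((hasSum_geometric_of_lt_one hinv0 hinv1).mul_left (4 * Δ * (a + b)))).congr_fun fun k => ?_
  ring

theorem exists_isChainingSequence (hγ : 0 < γ) (hh : 0 < h) (hC : 1 ≤ C) (hΔ : 1 ≤ Δ)
    (hHol : ∀ s t, D s t ≤ C ^ 2 * dist s t ^ γ) (hTail : ∀ s : ℝ≥0, T ≤ s → D s 0 ≤ s ^ (-h))
    (hdiam : ∀ s, D s 0 ≤ Δ ^ 2) :
    ∃ N π, IsChainingSequence D 0 (fun k => Δ * Δ⁻¹ ^ k) N π ∧
      ∀ k, ((N (k + 1)).card : ℝ) ≤ netCard γ h C T (Δ ^ k) := by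
  choose N π hN hD hcard using fun k : ℕ =>
    exists_net hγ hh hC hHol hTail (one_le_pow₀ hΔ (n := k))
  refine ⟨fun k => Nat.casesOn k {0} N, fun k => Nat.casesOn k (fun _ => 0) π,
    ⟨rfl, ?_, ?_⟩, hcard⟩
  · rintro (_ | k) s
    · exact Finset.mem_singleton_self _
    · exact hN k s
  · rintro (_ | k) s
    · simpa using hdiam s
    · have hscale : Δ * Δ⁻¹ ^ (k + 1) = (Δ ^ k)⁻¹ := by
        rw [pow_succ, inv_pow]
        field_simp
      simpa only [hscale] using hD k s

theorem lintegral_iSup_enorm_le_dudleyBound {Ω E : Type*} [MeasurableSpace Ω] {P : Measure Ω}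
    [IsProbabilityMeasure P] [NormedAddCommGroup E] {X : ℝ≥0 → Ω → E}
    (hX : ∀ s t, HasSubgaussianNorm (X s - X t) (D s t) P) (hX0 : X 0 = 0)
    (hγ : 0 < γ) (hγ2 : γ < 2) (hh : 0 < h) (hh1 : h ≤ 1) (hC : 1 ≤ C) (hΔ : 2 ≤ Δ)
    (hHol : ∀ s t, D s t ≤ C ^ 2 * dist s t ^ γ) (hTail : ∀ s : ℝ≥0, T ≤ s → D s 0 ≤ s ^ (-h))
    (hdiam : ∀ s, D s 0 ≤ Δ ^ 2) (F : Finset ℝ≥0) :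
    ∫⁻ ω, ⨆ s ∈ F, ‖X s ω‖ₑ ∂P ≤ ENNReal.ofReal (dudleyBound Δ γ h C T) := by
  have hΔ1 : 1 < Δ := by linarith
  obtain ⟨N, π, hN, hcard⟩ := exists_isChainingSequence hγ hh hC hΔ1.le hHol hTail hdiam
  refine hN.lintegral_iSup_enorm_le hX hX0 (fun k => by positivity) ?_ hcard (fun k => ?_)
    (hasSum_dudleyBound hΔ1 γ h C T) F
  · simpa using (tendsto_pow_atTop_nhds_zero_of_lt_one (by positivity)
      (inv_lt_one_of_one_lt₀ hΔ1)).const_mul Δ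
  · calc 2 * (Δ * Δ⁻¹ ^ k) * √(Real.log (4 * netCard γ h C T (Δ ^ k)))
        ≤ 2 * (Δ * Δ⁻¹ ^ k) * (2 * ((k + 1) * (√(Real.log Δ) * √(1 / γ + 1 / h)) +
          (√(1 / γ * Real.log C) + √(Real.log (max 1 T))))) := by
          gcongr
          exact sqrt_log_four_mul_netCard_le T hγ hγ2 hh hh1 hC hΔ k
      _ = _ := by ring

end Dudley

section Dyadic

variable {α : Type*} [PseudoEMetricSpace α] {x w : ℝ≥0 → α} {K n : ℕ} {s t : ℝ≥0}

/-- The dyadic approximation of level `n` from below. -/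
noncomputable def dyadicFloor (n : ℕ) (s : ℝ≥0) : ℝ≥0 := gridFloor (2 ^ n)⁻¹ s

/-- The largest increment of `x` between neighbouring dyadic points of level `n` in `[0, K]`. -/
noncomputable def dyadicOsc (x : ℝ≥0 → α) (K n : ℕ) : ℝ≥0∞ :=
  ⨆ j ∈ Finset.range (K * 2 ^ n), edist (x ((2 ^ n)⁻¹ * j)) (x ((2 ^ n)⁻¹ * (j + 1 : ℕ)))

theorem edist_dyadicFloor_le_dyadicOsc {a : ℕ} (has : (2 ^ n)⁻¹ * a ≤ s)
    (hsa : s < (2 ^ n)⁻¹ * (a + 2 : ℕ)) (hsK : s < K) :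
    edist (x ((2 ^ n)⁻¹ * a)) (x (dyadicFloor n s)) ≤ dyadicOsc x K n := by
  have haK : a < K * 2 ^ n := by
    have haK : (a : ℝ≥0) < 2 ^ n * K := (inv_mul_lt_iff₀ (by positivity)).1 (has.trans_lt hsK)
    exact_mod_cast mul_comm (2 ^ n : ℝ≥0) K ▸ haK
  have hle : a ≤ ⌊s / (2 ^ n)⁻¹⌋₊ := Nat.le_floor ((le_div_iff₀' (by positivity)).2 has)
  have hlt : ⌊s / (2 ^ n)⁻¹⌋₊ < a + 2 :=
    (Nat.floor_lt zero_le).2 ((div_lt_iff₀' (by positivity)).2 hsa)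
  rw [dyadicFloor, gridFloor]
  obtain hfloor | hfloor : ⌊s / (2 ^ n)⁻¹⌋₊ = a ∨ ⌊s / (2 ^ n)⁻¹⌋₊ = a + 1 := by omega
  · rw [hfloor, edist_self]
    exact zero_le
  · rw [hfloor]
    exact le_iSup₂ (f := fun (j : ℕ) (_ : j ∈ Finset.range (K * 2 ^ n)) =>
      edist (x ((2 ^ n)⁻¹ * j)) (x ((2 ^ n)⁻¹ * (j + 1 : ℕ)))) a (Finset.mem_range.2 haK)

theorem edist_dyadicFloor_succ_le (x : ℝ≥0 → α) (n : ℕ) (hsK : s < K) :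
    edist (x (dyadicFloor n s)) (x (dyadicFloor (n + 1) s)) ≤ dyadicOsc x K (n + 1) := by
  have hhalf : ((2 : ℝ≥0) ^ n)⁻¹ = (2 ^ (n + 1))⁻¹ * 2 := by
    rw [pow_succ]
    field_simp
  have hfloor : dyadicFloor n s = (2 ^ (n + 1))⁻¹ * (2 * ⌊s / (2 ^ n)⁻¹⌋₊ : ℕ) := by
    rw [dyadicFloor, gridFloor, Nat.cast_mul, Nat.cast_two, ← mul_assoc, ← hhalf]
  have hle : dyadicFloor n s ≤ s := gridFloor_le _ s
  have hlt : s < dyadicFloor n s + (2 ^ n)⁻¹ := lt_gridFloor_add (by positivity) s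
  rw [hfloor] at hle hlt ⊢
  refine edist_dyadicFloor_le_dyadicOsc hle (hlt.trans_eq ?_) hsK
  rw [hhalf]
  push_cast
  ring

theorem edist_dyadicFloor_le (x : ℝ≥0 → α) (hst : s ≤ t) (hts : t < s + (2 ^ n)⁻¹) (htK : t < K) :
    edist (x (dyadicFloor n s)) (x (dyadicFloor n t)) ≤ dyadicOsc x K n := by
  refine edist_dyadicFloor_le_dyadicOsc ((gridFloor_le _ s).trans hst) ?_ htK
  calc t < s + (2 ^ n)⁻¹ := hts
    _ ≤ gridFloor (2 ^ n)⁻¹ s + (2 ^ n)⁻¹ + (2 ^ n)⁻¹ := by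
      gcongr
      exact (lt_gridFloor_add (by positivity) s).le
    _ = _ := by
      rw [gridFloor]
      push_cast
      ring

theorem exists_tendsto_dyadicFloor [CompleteSpace α] (hx : ∀ K, ∑' n, dyadicOsc x K n ≠ ⊤)
    (s : ℝ≥0) : ∃ z, Tendsto (fun n => x (dyadicFloor n s)) atTop (𝓝 z) := by
  obtain ⟨K, hsK⟩ := exists_nat_gt s
  refine cauchySeq_tendsto_of_complete (cauchySeq_of_edist_le_of_tsum_ne_top _
    (fun n => edist_dyadicFloor_succ_le x n hsK) (ne_top_of_le_ne_top (hx K) ?_))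
  exact ENNReal.tsum_comp_le_tsum_of_injective (add_left_injective 1) _

theorem edist_le_of_tendsto_dyadicFloor
    (hw : ∀ s, Tendsto (fun n => x (dyadicFloor n s)) atTop (𝓝 (w s)))
    (hst : s ≤ t) (hts : t < s + (2 ^ n)⁻¹) (htK : t < K) :
    edist (w s) (w t) ≤ ∑' m, dyadicOsc x K (n + m + 1) + dyadicOsc x K n +
      ∑' m, dyadicOsc x K (n + m + 1) := by
  have htail : ∀ {u : ℝ≥0}, u < K →
      edist (x (dyadicFloor n u)) (w u) ≤ ∑' m, dyadicOsc x K (n + m + 1) := fun {u} hu =>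
    edist_le_tsum_of_edist_le_of_tendsto _ (fun n => edist_dyadicFloor_succ_le x n hu) (hw u) n
  calc edist (w s) (w t)
      ≤ edist (w s) (x (dyadicFloor n s)) + edist (x (dyadicFloor n s)) (x (dyadicFloor n t)) +
        edist (x (dyadicFloor n t)) (w t) := edist_triangle4 _ _ _ _
    _ ≤ _ := by
      gcongr
      · exact edist_comm (w s) _ ▸ htail (hst.trans_lt htK)
      · exact edist_dyadicFloor_le x hst hts htK
      · exact htail htK

theorem continuous_of_tendsto_dyadicFloor (hx : ∀ K, ∑' n, dyadicOsc x K n ≠ ⊤)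
    (hw : ∀ s, Tendsto (fun n => x (dyadicFloor n s)) atTop (𝓝 (w s))) : Continuous w := by
  refine continuous_iff_continuousAt.2 fun s => EMetric.tendsto_nhds.2 fun ε hε => ?_
  obtain ⟨K, hsK⟩ := exists_nat_gt s
  have htail : Tendsto (fun n => ∑' m, dyadicOsc x K (n + m + 1)) atTop (𝓝 0) := by
    refine ((tendsto_add_atTop_iff_nat 1).2 (ENNReal.tendsto_sum_nat_add _ (hx K))).congr
      fun n => ?_
    exact tsum_congr fun m => congrArg _ (by ring)
  have hlim : Tendsto (fun n => ∑' m, dyadicOsc x K (n + m + 1) + dyadicOsc x K n +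
      ∑' m, dyadicOsc x K (n + m + 1)) atTop (𝓝 0) := by
    simpa using (htail.add (ENNReal.tendsto_atTop_zero_of_tsum_ne_top (hx K))).add htail
  obtain ⟨n, hn⟩ := (hlim.eventually (gt_mem_nhds hε)).exists
  have hmesh : s < s + (2 ^ n)⁻¹ := lt_add_of_pos_right _ (by positivity)
  filter_upwards [gt_mem_nhds hsK, gt_mem_nhds hmesh,
    (continuous_add_const _).continuousAt.eventually (lt_mem_nhds hmesh)] with t htK hts hst
  rcases le_total s t with h | h
  · exact (edist_comm (w t) (w s)).trans_le
      (edist_le_of_tendsto_dyadicFloor hw h hts htK) |>.trans_lt hn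
  · exact (edist_le_of_tendsto_dyadicFloor hw h hst hsK).trans_lt hn

end Dyadic

section Version

variable {Ω : Type*} [MeasurableSpace Ω] {P : Measure Ω} {E : Type*} [NormedAddCommGroup E]

theorem ae_tsum_ne_top {f : ℕ → Ω → ℝ≥0∞} (hf : ∀ n, AEMeasurable (f n) P) {b : ℕ → ℝ}
    (hb : Summable b) (hfb : ∀ n, ∫⁻ ω, f n ω ∂P ≤ ENNReal.ofReal (b n)) :
    ∀ᵐ ω ∂P, ∑' n, f n ω ≠ ⊤ := by
  refine (ae_lt_top' (AEMeasurable.tsum hf) ?_).mono fun _ h => h.ne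
  rw [lintegral_tsum hf]
  exact ne_top_of_le_ne_top hb.tsum_ofReal_ne_top (ENNReal.tsum_le_tsum hfb)

theorem summable_geometric_mul_sqrt_log {ρ : ℝ} (hρ0 : 0 ≤ ρ) (hρ : ρ < 1) (C : ℝ) (K : ℕ) :
    Summable fun n : ℕ => 2 * (C * ρ ^ n) * √(Real.log (4 * ((K + 1) * 2 ^ n))) := by
  have hρ' : ‖ρ‖ < 1 := by rwa [Real.norm_of_nonneg hρ0]
  have hlinear : Summable fun n : ℕ => (n : ℝ) ^ 1 * ρ ^ n :=
    summable_pow_mul_geometric_of_norm_lt_one 1 hρ'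
  refine Summable.of_norm_bounded
    (((summable_geometric_of_norm_lt_one hρ').mul_left (2 * |C| * Real.log (4 * (K + 1)))).add
      (hlinear.mul_left (2 * |C| * Real.log 2))) fun n => ?_
  have hone : 1 ≤ Real.log (4 * ((K + 1) * 2 ^ n)) := one_le_log_four_mul
    (one_le_mul_of_one_le_of_one_le (by simp) (one_le_pow₀ one_le_two))
  rw [Real.norm_eq_abs, abs_mul, abs_mul, abs_mul, abs_two, abs_of_nonneg (Real.sqrt_nonneg _),
    abs_of_nonneg (pow_nonneg hρ0 n)]
  calc 2 * (|C| * ρ ^ n) * √(Real.log (4 * ((K + 1) * 2 ^ n)))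
      ≤ 2 * (|C| * ρ ^ n) * Real.log (4 * ((K + 1) * 2 ^ n)) := by
        gcongr
        exact (Real.sqrt_le_left (by linarith)).2 (le_self_pow₀ hone two_ne_zero)
    _ = _ := by
        rw [← mul_assoc 4, Real.log_mul (by positivity) (by positivity), Real.log_pow]
        ring

variable [IsProbabilityMeasure P] {X : ℝ≥0 → Ω → E} {D : ℝ≥0 → ℝ≥0 → ℝ} {γ C : ℝ}

theorem le_sq_of_dist_le (hγ : 0 < γ) (hHol : ∀ s t, D s t ≤ C ^ 2 * dist s t ^ γ) {n : ℕ}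
    {s t : ℝ≥0} (hst : dist s t ≤ (2 ^ n)⁻¹) : D s t ≤ (C * ((2⁻¹ : ℝ) ^ (γ / 2)) ^ n) ^ 2 :=
  calc D s t ≤ C ^ 2 * dist s t ^ γ := hHol s t
    _ ≤ C ^ 2 * ((2 ^ n)⁻¹) ^ γ := by gcongr
    _ = _ := by
      rw [mul_pow, ← Real.rpow_mul_natCast (by positivity), ← Real.rpow_mul_natCast (by positivity),
        ← inv_pow, ← Real.rpow_natCast_mul (by positivity)]
      congr 2
      push_cast
      ring

theorem ae_tsum_dyadicOsc_ne_top (hX : ∀ s t, HasSubgaussianNorm (X s - X t) (D s t) P)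
    (hγ : 0 < γ) (hC : 0 < C) (hHol : ∀ s t, D s t ≤ C ^ 2 * dist s t ^ γ) (K : ℕ) :
    ∀ᵐ ω ∂P, ∑' n, dyadicOsc (fun s => X s ω) K n ≠ ⊤ := by
  have hρ : (2⁻¹ : ℝ) ^ (γ / 2) < 1 :=
    Real.rpow_lt_one (by norm_num) (by norm_num) (by positivity)
  simp only [dyadicOsc, edist_eq_enorm_sub]
  refine ae_tsum_ne_top (fun n => ?_)
    (summable_geometric_mul_sqrt_log (by positivity) hρ C K) fun n => ?_
  · exact AEMeasurable.biSup _ (Finset.range (K * 2 ^ n)).countable_toSet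
      fun j _ => (hX _ _).aestronglyMeasurable.enorm
  · refine lintegral_iSup_enorm_le (I := Finset.range (K * 2 ^ n))
      (Z := fun j => X ((2 ^ n)⁻¹ * j) - X ((2 ^ n)⁻¹ * (j + 1 : ℕ))) (by positivity)
      (fun j _ => (hX _ _).mono (le_sq_of_dist_le hγ hHol ?_))
      (one_le_mul_of_one_le_of_one_le (by simp) (one_le_pow₀ one_le_two)) ?_
    · rw [NNReal.dist_eq]
      push_cast
      rw [← mul_sub, sub_add_cancel_left, mul_neg_one, abs_neg, abs_of_nonneg (by positivity)]
    · rw [Finset.card_range]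
      push_cast
      gcongr
      linarith

theorem ae_tendsto_dyadicFloor (hX : ∀ s t, HasSubgaussianNorm (X s - X t) (D s t) P)
    (hγ : 0 < γ) (hC : 0 < C) (hHol : ∀ s t, D s t ≤ C ^ 2 * dist s t ^ γ) (s : ℝ≥0) :
    ∀ᵐ ω ∂P, Tendsto (fun n => X (dyadicFloor n s) ω) atTop (𝓝 (X s ω)) := by
  have hρ : (2⁻¹ : ℝ) ^ (γ / 2) < 1 :=
    Real.rpow_lt_one (by norm_num) (by norm_num) (by positivity)
  have hsum : ∀ᵐ ω ∂P, ∑' n, ‖X s ω - X (dyadicFloor n s) ω‖ₑ ≠ ⊤ := by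
    refine ae_tsum_ne_top (fun n => (hX _ _).aestronglyMeasurable.enorm)
      (summable_geometric_mul_sqrt_log (by positivity) hρ C 0) fun n => ?_
    have hdist : dist s (dyadicFloor n s) ≤ (2 ^ n)⁻¹ := dist_gridFloor_le (by positivity) s
    simpa using lintegral_iSup_enorm_le (I := {s}) (Z := fun s => X s - X (dyadicFloor n s))
      (n := 2 ^ n) (by positivity)
      (fun u hu => Finset.mem_singleton.1 hu ▸ (hX _ _).mono (le_sq_of_dist_le hγ hHol hdist))
      (one_le_pow₀ one_le_two) (by simpa using one_le_pow₀ one_le_two)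
  filter_upwards [hsum] with ω hω
  rw [tendsto_iff_edist_tendsto_0]
  simpa only [edist_comm, edist_eq_enorm_sub] using ENNReal.tendsto_atTop_zero_of_tsum_ne_top hω

theorem exists_continuous_modification [CompleteSpace E]
    (hX : ∀ s t, HasSubgaussianNorm (X s - X t) (D s t) P) (hγ : 0 < γ) (hC : 0 < C)
    (hHol : ∀ s t, D s t ≤ C ^ 2 * dist s t ^ γ) :
    ∃ W : ℝ≥0 → Ω → E, (∀ s, W s =ᵐ[P] X s) ∧ ∀ᵐ ω ∂P, Continuous fun s => W s ω := by
  refine ⟨fun s ω => limUnder atTop fun n => X (dyadicFloor n s) ω, fun s => ?_, ?_⟩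
  · filter_upwards [ae_tendsto_dyadicFloor hX hγ hC hHol s] with ω hω using hω.limUnder_eq
  · filter_upwards [ae_all_iff.2 (ae_tsum_dyadicOsc_ne_top hX hγ hC hHol)] with ω hω
    exact continuous_of_tendsto_dyadicFloor hω fun s =>
      tendsto_nhds_limUnder (exists_tendsto_dyadicFloor hω s)

end Version

section Supremum

variable {Ω : Type*} [MeasurableSpace Ω] {P : Measure Ω}

theorem lintegral_iSup_le_of_continuous {ι : Type*} [TopologicalSpace ι]
    [TopologicalSpace.SeparableSpace ι] {f : ι → Ω → ℝ≥0∞} (hf : ∀ i, AEMeasurable (f i) P)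
    (hcont : ∀ᵐ ω ∂P, Continuous fun i => f i ω) {B : ℝ≥0∞}
    (hB : ∀ F : Finset ι, ∫⁻ ω, ⨆ i ∈ F, f i ω ∂P ≤ B) : ∫⁻ ω, ⨆ i, f i ω ∂P ≤ B := by
  classical
  obtain ⟨S, hScount, hSdense⟩ := TopologicalSpace.exists_countable_dense ι
  have := hScount.to_subtype
  calc ∫⁻ ω, ⨆ i, f i ω ∂P = ∫⁻ ω, ⨆ F : Finset S, ⨆ i ∈ F, f i ω ∂P := by
        refine lintegral_congr_ae (hcont.mono fun ω hω => ?_)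
        dsimp only
        rw [← hSdense.ciSup' hω, iSup_eq_iSup_finset]
    _ = ⨆ F : Finset S, ∫⁻ ω, ⨆ i ∈ F, f i ω ∂P :=
        lintegral_iSup_directed
          (fun F => AEMeasurable.biSup _ F.countable_toSet fun i _ => hf i)
          (Monotone.directed_le fun F G hFG ω => biSup_mono fun i hi => Finset.mem_of_subset hFG hi)
    _ ≤ B := iSup_le fun F => by
        simpa only [Finset.mem_image, iSup_exists, iSup_and, iSup_comm (ι := ι),
          iSup_iSup_eq_right] using hB (F.image (↑))

end Supremum

section Threshold

variable {Ω : Type*} [MeasurableSpace Ω] {P : Measure Ω}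
  {Φ : ℝ → Ω → ℝ} {p : ℝ → ℝ} {ψ : ℝ → ℂ} {γ C₁ h T : ℝ}

theorem distSq_le_holderConst (hpi : Integrable p) (hp : HighFrequencyDecay p γ C₁)
    (hψ : IsAnalyticWavelet ψ) (hlip : ∃ K : ℝ≥0, LipschitzOnWith K (fourierHat ψ) (Ici 0))
    {s t : ℝ} (hs : 0 ≤ s) (ht : 0 ≤ t) :
    distSq p ψ s t ≤ holderConst P ψ Φ γ C₁ ^ 2 * |s - t| ^ γ := by
  refine (distSq_le_rpow hpi hp hψ hlip hs ht).trans ?_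
  gcongr
  have hγ := hp.gamma_pos
  have hγ2 : 0 < 2 - γ := by linarith [hp.gamma_lt_two]
  have hC := hp.const_pos
  have hM := supNorm_nonneg (fourierHat ψ)
  have hK := lipConst_nonneg (fourierHat ψ)
  set I := C₁ * (1 / γ + 2 / (2 - γ)) * (2 * supNorm (fourierHat ψ)) ^ (2 - γ)
        * lipConst (fourierHat ψ) ^ γ + 2 * supNorm (fourierHat ψ) ^ 2 * Var[Φ 0; P]
  have hvar : 0 ≤ 2 * supNorm (fourierHat ψ) ^ 2 * Var[Φ 0; P] :=
    mul_nonneg (by positivity) (variance_nonneg _ _)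
  have hI : 0 ≤ I := add_nonneg (by positivity) hvar
  calc C₁ * (1 / γ + 1 / (2 - γ)) * (2 * supNorm (fourierHat ψ)) ^ (2 - γ)
        * lipConst (fourierHat ψ) ^ γ ≤ I := by
        refine le_add_of_le_of_nonneg ?_ hvar
        gcongr
        norm_num
    _ = √I ^ 2 := (Real.sq_sqrt hI).symm
    _ ≤ holderConst P ψ Φ γ C₁ ^ 2 := pow_le_pow_left₀ (Real.sqrt_nonneg _) (le_max_right _ _) 2

theorem IsContinuousVersion.lintegral_iSup_enorm_le {W : ℝ → Ω → ℂ}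
    (hW : IsContinuousVersion P ψ Φ W)
    (hmeas : ∀ s, 0 < s → AEStronglyMeasurable (awtNoise ψ Φ s) P)
    {B : ℝ≥0∞} (hB : ∀ F : Finset ℝ≥0, ∫⁻ ω, ⨆ s ∈ F, ‖awtNoise ψ Φ s ω‖ₑ ∂P ≤ B) :
    ∫⁻ ω, ⨆ s ∈ Ioi (0 : ℝ), ‖W s ω‖ₑ ∂P ≤ B := by
  classical
  simp only [iSup_subtype']
  refine lintegral_iSup_le_of_continuous (ι := Ioi (0 : ℝ)) (f := fun s ω => ‖W s ω‖ₑ)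
    (fun s => ((hmeas s s.2).congr (hW.ae_eq s s.2).symm).enorm)
    (hW.continuousOn.mono fun ω hω => (continuousOn_iff_continuous_domRestrict.1 hω).enorm)
    fun F => ?_
  have hae : ∀ᵐ ω ∂P, ∀ s ∈ F, W s ω = awtNoise ψ Φ s ω :=
    (F.eventually_all).2 fun s _ => hW.ae_eq s s.2
  refine (lintegral_mono_ae (hae.mono fun ω hω => iSup₂_le fun s hs => ?_)).trans
    (hB (F.image fun s : Ioi (0 : ℝ) => (s : ℝ).toNNReal))
  rw [hω s hs]
  refine le_iSup₂_of_le _ (Finset.mem_image_of_mem _ hs) ?_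
  rw [Real.coe_toNNReal _ s.2.le]

variable [IsProbabilityMeasure P]

theorem distSq_zero_le_diamConst (hΦ : IsGaussianNoise P Φ p)
    (hm : Measurable (Function.uncurry Φ)) (hψ : IsAnalyticWavelet ψ) {s : ℝ} (hs : 0 ≤ s) :
    distSq p ψ s 0 ≤ diamConst P ψ Φ ^ 2 := by
  rcases hs.eq_or_lt with rfl | hs
  · simp [distSq, sq_nonneg]
  have hp0 : ∀ l, 0 ≤ p l := fun l => (hΦ.density_pos l).le
  have hbdd : BddAbove (range fun s : Ioi (0 : ℝ) => secondMoment P ψ Φ (s : ℝ)) := by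
    refine ⟨(∫ l, p l) * (2 * supNorm (fourierHat ψ)) ^ 2, forall_mem_range.2 fun u => ?_⟩
    rw [secondMoment_eq_distSq hΦ hm hψ u.2.le]
    exact distSq_le_integral_mul hp0 hΦ.density_integrable hψ.integrable _ _
  have hsup : distSq p ψ s 0 ≤ ⨆ u : Ioi (0 : ℝ), secondMoment P ψ Φ (u : ℝ) :=
    (secondMoment_eq_distSq hΦ hm hψ hs.le).symm.trans_le (le_ciSup hbdd ⟨s, hs⟩)
  calc distSq p ψ s 0 ≤ _ := hsup
    _ = √(⨆ u : Ioi (0 : ℝ), secondMoment P ψ Φ (u : ℝ)) ^ 2 :=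
      (Real.sq_sqrt ((distSq_nonneg hp0 _ _).trans hsup)).symm
    _ ≤ _ := pow_le_pow_left₀ (Real.sqrt_nonneg _) (le_max_right _ _) 2

theorem exists_isContinuousVersion (hΦ : IsGaussianNoise P Φ p)
    (hm : Measurable (Function.uncurry Φ)) (hp : HighFrequencyDecay p γ C₁)
    (hψ : IsAnalyticWavelet ψ) (hlip : ∃ K : ℝ≥0, LipschitzOnWith K (fourierHat ψ) (Ici 0)) :
    ∃ W : ℝ → Ω → ℂ, IsContinuousVersion P ψ Φ W := by
  obtain ⟨W, hWae, hWcont⟩ := exists_continuous_modification (X := fun s : ℝ≥0 => awtNoise ψ Φ s)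
    (D := fun s t => distSq p ψ s t) (C := holderConst P ψ Φ γ C₁)
    (fun s t => hasSubgaussianNorm_awtNoise_sub hΦ hm hψ s.2 t.2) hp.gamma_pos
    (zero_lt_one.trans_le (le_max_left _ _))
    (fun s t => distSq_le_holderConst hΦ.density_integrable hp hψ hlip s.2 t.2)
  refine ⟨fun s => W s.toNNReal, fun s hs => ?_, ?_⟩
  · simpa only [Real.coe_toNNReal s hs.le] using hWae s.toNNReal
  · exact hWcont.mono fun ω hω => (hω.comp continuous_real_toNNReal).continuousOn

theorem exists_isDecayThreshold (hΦ : IsGaussianNoise P Φ p)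
    (hm : Measurable (Function.uncurry Φ)) (hψ : IsAnalyticWavelet ψ) (hh : 0 < h)
    (hp : LowFrequencyBound p h) : ∃ T, IsDecayThreshold P ψ Φ h T := by
  obtain ⟨T, hT0, hT⟩ := hp.exists_distSq_zero_le_rpow_neg hΦ.density_integrable hψ hh
  refine ⟨T, hT0, fun s hs => ?_⟩
  rw [secondMoment_eq_distSq hΦ hm hψ (hT0.le.trans hs)]
  exact hT s hs

theorem lintegral_iSup_awtNoise_le (hΦ : IsGaussianNoise P Φ p)
    (hm : Measurable (Function.uncurry Φ)) (hp : HighFrequencyDecay p γ C₁)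
    (hψ : IsAnalyticWavelet ψ) (hlip : ∃ K : ℝ≥0, LipschitzOnWith K (fourierHat ψ) (Ici 0))
    (hh : 0 < h) (hh1 : h ≤ 1) (hT : IsDecayThreshold P ψ Φ h T) (F : Finset ℝ≥0) :
    ∫⁻ ω, ⨆ s ∈ F, ‖awtNoise ψ Φ s ω‖ₑ ∂P ≤
      ENNReal.ofReal (dudleyBound (diamConst P ψ Φ) γ h (holderConst P ψ Φ γ C₁) T) :=
  lintegral_iSup_enorm_le_dudleyBound (X := fun s : ℝ≥0 => awtNoise ψ Φ s)
    (D := fun s t => distSq p ψ s t)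
    (fun s t => hasSubgaussianNorm_awtNoise_sub hΦ hm hψ s.2 t.2) (awtNoise_zero ψ Φ)
    hp.gamma_pos hp.gamma_lt_two hh hh1 (le_max_left _ _) (le_max_left _ _)
    (fun s t => distSq_le_holderConst hΦ.density_integrable hp hψ hlip s.2 t.2)
    (fun s hs => secondMoment_eq_distSq hΦ hm hψ s.2 ▸ hT.2 s hs)
    (fun s => distSq_zero_le_diamConst hΦ hm hψ s.2) F

end Threshold

end AWT

theorem mainTheorem6_general {Ω : Type*} [MeasurableSpace Ω] (P : Measure Ω)
    [IsProbabilityMeasure P] (Φ : ℝ → Ω → ℝ) (hΦ_meas : Measurable (fun q : ℝ × Ω => Φ q.1 q.2))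
    (p : ℝ → ℝ) (hΦ : AWT.IsGaussianNoise P Φ p)
    (ψ : ℝ → ℂ) (hψ : AWT.IsAnalyticWavelet ψ)
    (hψ_lip : ∃ K : NNReal, LipschitzOnWith K (AWT.fourierHat ψ) (Ici 0))
    (γ C₁ : ℝ) (hp : AWT.HighFrequencyDecay p γ C₁)
    (h : ℝ) (hh : 0 < h) (hh1 : h ≤ 1) :
    (∃ W : ℝ → Ω → ℂ, AWT.IsContinuousVersion P ψ Φ W) ∧
    (AWT.LowFrequencyBound p h → ∃ T : ℝ, AWT.IsDecayThreshold P ψ Φ h T) ∧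
    ∀ T : ℝ, AWT.IsDecayThreshold P ψ Φ h T →
      ∀ W : ℝ → Ω → ℂ, AWT.IsContinuousVersion P ψ Φ W →
        ∫⁻ ω, ⨆ s ∈ Ioi (0 : ℝ), ‖W s ω‖ₑ ∂P ≤
          ENNReal.ofReal (AWT.dudleyBound (AWT.diamConst P ψ Φ) γ h
            (AWT.holderConst P ψ Φ γ C₁) T) := by
  refine ⟨AWT.exists_isContinuousVersion hΦ hΦ_meas hp hψ hψ_lip,
    AWT.exists_isDecayThreshold hΦ hΦ_meas hψ hh, fun T hT W hW => ?_⟩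
  refine hW.lintegral_iSup_enorm_le (fun s hs => ?_)
    (AWT.lintegral_iSup_awtNoise_le hΦ hΦ_meas hp hψ hψ_lip hh hh1 hT)
  simpa only [AWT.awtNoise_zero, sub_zero] using
    (AWT.hasSubgaussianNorm_awtNoise_sub hΦ hΦ_meas hψ hs.le le_rfl).aestronglyMeasurable

theorem mainTheorem6 {Ω : Type*} [MeasurableSpace Ω] (P : Measure Ω) [IsProbabilityMeasure P]
    (Φ : ℝ → Ω → ℝ) (hΦ_meas : Measurable (fun q : ℝ × Ω => Φ q.1 q.2))
    (p : ℝ → ℝ) (hΦ : AWT.IsGaussianNoise P Φ p)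
    (ψ : ℝ → ℂ) (hψ : AWT.IsAnalyticWavelet ψ)
    (hψ_lip : ∃ K : NNReal, LipschitzOnWith K (AWT.fourierHat ψ) (Ici 0))
    (γ C₁ : ℝ) (hp : AWT.HighFrequencyDecay p γ C₁)
    (h : ℝ) (hh : 0 < h)
    (hdep : (∃ H : ℝ, AWT.LongRangeDependent p H ∧ h < H) ∨
      (AWT.ShortRangeDependent p ∧ h ≤ 1)) :
    (∃ W : ℝ → Ω → ℂ, AWT.IsContinuousVersion P ψ Φ W) ∧
    (h < 1 → ∃ T : ℝ, AWT.IsDecayThreshold P ψ Φ h T) ∧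
    ∀ T : ℝ, AWT.IsDecayThreshold P ψ Φ h T →
      ∀ W : ℝ → Ω → ℂ, AWT.IsContinuousVersion P ψ Φ W →
        ∫⁻ ω, ⨆ s ∈ Ioi (0 : ℝ), ‖W s ω‖ₑ ∂P ≤
          ENNReal.ofReal (AWT.dudleyBound (AWT.diamConst P ψ Φ) γ h
            (AWT.holderConst P ψ Φ γ C₁) T) := by
  obtain ⟨hversion, hthreshold, hsup⟩ := mainTheorem6_general P Φ hΦ_meas p hΦ ψ hψ hψ_lip γ C₁ hp
    h hh (hdep.elim (fun ⟨_, hH, hhH⟩ => (hhH.trans hH.2.1).le) And.right)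
  exact ⟨hversion, fun hh1 => hthreshold (hdep.elim
    (fun ⟨_, hH, hhH⟩ => hH.lowFrequencyBound hp hhH) fun hS => hS.1.lowFrequencyBound hh1), hsup⟩
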